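/- Let $p\ge 0$ and let $k_1,\dots,k_p\ge 1$ be block sizes, $m=k_1+\dots+k_p$. Let $\bar\theta=(\bar\theta^{(1)},\dots,\bar\theta^{(p)})\in\mathbb R^m$ be a fixed vector with blocks $\bar\theta^{(i)}\in\mathbb R^{k_i}$, and let $\sigma>0$ and $\gamma\ge 0$ be known constants. For every $n$ let $G_n$ be a random $n\times m$ matrix whose rows are independent copies of a zero-mean, square-integrable random vector in $\mathbb R^m$ (the same for all $n$) with positive definite covariance matrix $\Psi$. Let $v_n\sim\mathcal N(0,\sigma^2 I_n)$ be independent of $G_n$, and let $$y_n=G_n\bar\theta+v_n .$$ For $\lambda\in\mathbb R_+^p$, where $\mathbb R_+=[0,\infty)$, put $\Lambda=\mathrm{blockdiag}(\lambda_1I_{k_1},\dots,\lambda_pI_{k_p})$ and $\Sigma_y(\lambda)=G_n\Lambda G_n^\top+\sigma^2I_n$. Let $1\le q\le\infty$ and let $\mathcal C=\{\lambda\in\mathbb R^p:\|\lambda\|_q\le R\}$ be a closed ball around the origin in the $\ell^q$ norm, whose radius $R$ is larger than the $\ell^q$ norm of the vector $\big(\|\bar\theta^{(i)}\|^2/k_i\big)_{i=1}^p$,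 where $\|\cdot\|$ is the Euclidean norm. For $q=\infty$ this means $R>\max_i\|\bar\theta^{(i)}\|^2/k_i$. Then for all $n$, and for all realizations of $G_n$ and $v_n$, the objective $$\tfrac12\log\det\Sigma_y(\lambda)+\tfrac12\,y_n^\top\Sigma_y(\lambda)^{-1}y_n+\gamma\sum_{i=1}^p\lambda_i$$ attains its minimum over $\mathcal C\cap\mathbb R_+^p$. Moreover, if $\hat\lambda^n$ is, for every $n$ and almost surely, any such minimizer, then for every $i$, as $n\to\infty$ and in probability, $$\hat\lambda_i^n\to\frac{-k_i+\sqrt{k_i^2+8\gamma\|\bar\theta^{(i)}\|^2}}{4\gamma}\quad\text{if }\gamma>0\text{ and }\|\bar\theta^{(i)}\|>0,$$ $$\hat\lambda_i^n\to\frac{\|\bar\theta^{(i)}\|^2}{k_i}\quad\text{if }\gamma=0\text{ and }\|\bar\theta^{(i)}\|>0,$$ $$\hat\lambda_i^n\to0\quad\text{if }\gamma\ge0\text{ and }\|\bar\theta^{(i)}\|=0.$$ (The case $\gamma=0$ gives the asymptotics of ARD.) -/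

import Mathlib

open MeasureTheory ProbabilityTheory Filter
open scoped ENNReal Matrix

noncomputable section

namespace HGLasso

/-- The index set of the `m = k₁ + ⋯ + k_p` regressors, partitioned into `p` blocks, the `i`-th of
size `k i`. The pair `⟨i, a⟩` is the `a`-th coordinate of the `i`-th block. -/
abbrev Idx {p : ℕ} (k : Fin p → ℕ) : Type := Σ i : Fin p, Fin (k i)

/-- Stacks the blocks `θ⁽¹⁾, …, θ⁽ᵖ⁾` into one vector `θ`. -/
def stack {p : ℕ} {k : Fin p → ℕ} (θ : (i : Fin p) → EuclideanSpace ℝ (Fin (k i))) :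
    Idx k → ℝ :=
  fun s => θ s.1 s.2

/-- The measurement model `y = G θ + v`; `G j` is the `j`-th row of the design matrix. -/
def observation {p n : ℕ} {k : Fin p → ℕ} (θ : (i : Fin p) → EuclideanSpace ℝ (Fin (k i)))
    (G : Fin n → Idx k → ℝ) (v : Fin n → ℝ) : Fin n → ℝ :=
  Matrix.of G *ᵥ stack θ + v

/-- `Λ = blockdiag(λ₁ I_{k₁}, …, λ_p I_{k_p})`. -/
def blockLambda {p : ℕ} (k : Fin p → ℕ) (l : Fin p → ℝ) : Matrix (Idx k) (Idx k) ℝ :=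
  Matrix.diagonal fun s => l s.1

/-- `Σ_y(λ) = G Λ Gᵀ + σ² I`. -/
def sigmaY {p n : ℕ} {k : Fin p → ℕ} (σ : ℝ) (G : Fin n → Idx k → ℝ) (l : Fin p → ℝ) :
    Matrix (Fin n) (Fin n) ℝ :=
  Matrix.of G * blockLambda k l * (Matrix.of G)ᵀ + σ ^ 2 • (1 : Matrix (Fin n) (Fin n) ℝ)

/-- The objective `½ log det Σ_y(λ) + ½ yᵀ Σ_y(λ)⁻¹ y + γ ∑ᵢ λᵢ`, that is, up to an additive
constant, minus the logarithm of the marginal posterior density of `λ` given `y`. -/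
def objective {p n : ℕ} {k : Fin p → ℕ} (σ γ : ℝ) (G : Fin n → Idx k → ℝ) (y : Fin n → ℝ)
    (l : Fin p → ℝ) : ℝ :=
  1 / 2 * Real.log (sigmaY σ G l).det + 1 / 2 * (y ⬝ᵥ ((sigmaY σ G l)⁻¹ *ᵥ y)) + γ * ∑ i, l i

/-- The `ℓ^q` norm on `ℝᵖ`: the maximum norm for `q = ∞`, the Euclidean norm for `q = 2`. -/
def lqNorm {p : ℕ} (q : ℝ≥0∞) [Fact (1 ≤ q)] (l : Fin p → ℝ) : ℝ :=
  ‖(WithLp.toLp q l : PiLp q fun _ : Fin p => ℝ)‖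

/-- The intersection of the closed `ℓ^q` ball of radius `R` around `0` with the nonnegative
orthant of `ℝᵖ`. -/
def feasible (p : ℕ) (q : ℝ≥0∞) [Fact (1 ≤ q)] (R : ℝ) : Set (Fin p → ℝ) :=
  {l | lqNorm q l ≤ R ∧ ∀ i, 0 ≤ l i}

/-- `l` belongs to the argmin of the objective over the feasible set. -/
def IsEstimate {p n : ℕ} {k : Fin p → ℕ} (q : ℝ≥0∞) [Fact (1 ≤ q)] (R σ γ : ℝ)
    (G : Fin n → Idx k → ℝ) (y : Fin n → ℝ) (l : Fin p → ℝ) : Prop :=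
  l ∈ feasible p q R ∧ IsMinOn (objective σ γ G y) (feasible p q R) l

end HGLasso

end

/-!
Write `A` for the design matrix, `Σ = A Λ Aᵀ + σ² I`, `u = Aᵀ Σ⁻¹ y`, and let `x = Λ u - θ` be the
error of the posterior mean of `θ` at the hyperparameters `λ`. Existence of a minimizer is
compactness of the feasible set and continuity of the objective.

Consistency rests on two facts about a minimizer `λ`.

* The error `x` is small. Comparing the objective at `λ` with its value at the feasible point
  `(‖θ⁽ⁱ⁾‖² / kᵢ)ᵢ`, the contributions of order `n` cancel and there remains
  `‖A x‖² - 2 x · Aᵀ v ≤ σ² (C + log det (I + B Aᵀ A))` for a fixed matrix `B`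
  (`IsEstimate.energy_le`). The determinant has a fixed size, so its logarithm is at most
  `O(log n)` (`exists_log_det_le`). As `Aᵀ A / n → Ψ` is
  positive definite and `Aᵀ v / n → 0`, this forces `x → 0` (`tendsto_posteriorError`).
* First order optimality is almost an equation for `λᵢ`. The partial derivative of twice the
  objective in `λᵢ` is `tr Bᵢ - ‖u⁽ⁱ⁾‖² + 2 γ` with `Bᵢ` the `i`-th diagonal block of `Aᵀ Σ⁻¹ A`.
  Multiply by `λᵢ²`: then `λᵢ u⁽ⁱ⁾ = θ⁽ⁱ⁾ + x⁽ⁱ⁾`, while `λᵢ² tr Bᵢ` lies between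
  `kᵢ λᵢ - O(1 / n)` and `kᵢ λᵢ`. Decreasing `λᵢ` is always admissible, which gives
  `kᵢ λᵢ + 2 γ λᵢ² ≤ ‖θ⁽ⁱ⁾ + x⁽ⁱ⁾‖² + O(1 / n)` (`IsEstimate.le_sum_sq`). Hence `λᵢ` is
  asymptotically at most `‖θ⁽ⁱ⁾‖² / kᵢ`, so the minimizer lies strictly inside the ball, and
  increasing `λᵢ` is admissible too, which gives the reverse inequality
  (`IsEstimate.sum_sq_le`).

So `kᵢ λᵢ + 2 γ λᵢ² → ‖θ⁽ⁱ⁾‖²` (`tendsto_stationarity`), and all three limits of the theorem are the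
nonnegative root of `kᵢ r + 2 γ r² = ‖θ⁽ⁱ⁾‖²`. The argument is carried out for deterministic
sequences of samples and turned into a statement with tolerances (`exists_tolerance`); the
required convergence of `Aᵀ A / n` and `Aᵀ v / n` in probability is the weak law of large numbers
(`tendsto_measure_sample_mean`), which only needs second moments of the rows.
-/

namespace HGLasso

open scoped Topology

/-! ### Matrices of the form `A D Aᵀ + s I` -/

theorem dotProduct_mulVec_transpose {ι κ : Type*} [Fintype ι] [Fintype κ] (A : Matrix ι κ ℝ)
    (z : ι → ℝ) (x : κ → ℝ) : z ⬝ᵥ A *ᵥ x = (Aᵀ *ᵥ z) ⬝ᵥ x := by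
  rw [Matrix.dotProduct_mulVec, Matrix.mulVec_transpose]

section CovMatrix

variable {ι κ : Type*} [DecidableEq ι] [Fintype κ] [DecidableEq κ]

/-- The matrix `A diag(d) Aᵀ + s I`: the covariance of `A θ + v` when the coordinates of `θ` are
uncorrelated with variances `d` and `v` is white noise of variance `s`. -/
def covMat (s : ℝ) (A : Matrix ι κ ℝ) (d : κ → ℝ) : Matrix ι ι ℝ :=
  A * Matrix.diagonal d * Aᵀ + s • (1 : Matrix ι ι ℝ)

variable {s : ℝ} {A : Matrix ι κ ℝ} {d : κ → ℝ}

theorem covMat_transpose : (covMat s A d)ᵀ = covMat s A d := by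
  simp [covMat, Matrix.transpose_mul, Matrix.mul_assoc]

theorem continuous_covMat (s : ℝ) (A : Matrix ι κ ℝ) : Continuous fun d => covMat s A d := by
  have h1 : Continuous fun d : κ → ℝ => Matrix.diagonal d := continuous_id.matrix_diagonal
  have h2 : Continuous fun d : κ → ℝ => A * Matrix.diagonal d := continuous_const.matrix_mul h1
  exact (h2.matrix_mul continuous_const).add continuous_const

variable [Fintype ι]

theorem covMat_mulVec (z : ι → ℝ) :
    covMat s A d *ᵥ z = A *ᵥ (fun j => d j * (Aᵀ *ᵥ z) j) + s • z := by
  rw [covMat, Matrix.add_mulVec, Matrix.smul_mulVec, Matrix.one_mulVec, ← Matrix.mulVec_mulVec,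
    ← Matrix.mulVec_mulVec]
  congr 2
  ext j
  rw [Matrix.mulVec_diagonal]

theorem dotProduct_covMat_mulVec (z : ι → ℝ) :
    z ⬝ᵥ covMat s A d *ᵥ z = ∑ j, d j * (Aᵀ *ᵥ z) j ^ 2 + s * (z ⬝ᵥ z) := by
  rw [covMat_mulVec, dotProduct_add, dotProduct_mulVec_transpose, dotProduct_smul, smul_eq_mul]
  congr 1
  exact Finset.sum_congr rfl fun j _ => by ring

theorem posDef_covMat (hs : 0 < s) (hd : ∀ j, 0 ≤ d j) : (covMat s A d).PosDef := by
  refine Matrix.PosDef.of_dotProduct_mulVec_pos ?_ fun x hx => ?_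
  · rw [Matrix.IsHermitian, Matrix.conjTranspose_eq_transpose_of_trivial, covMat_transpose]
  · rw [star_trivial, dotProduct_covMat_mulVec]
    have h1 : 0 ≤ ∑ j, d j * (Aᵀ *ᵥ x) j ^ 2 :=
      Finset.sum_nonneg fun j _ => mul_nonneg (hd j) (sq_nonneg _)
    have h2 : 0 < x ⬝ᵥ x := by
      simpa using Matrix.dotProduct_star_self_pos_iff.2 hx
    positivity

theorem covMat_mulVec_inv_mulVec (hs : 0 < s) (hd : ∀ j, 0 ≤ d j) (y : ι → ℝ) :
    covMat s A d *ᵥ ((covMat s A d)⁻¹ *ᵥ y) = y := by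
  rw [Matrix.mulVec_mulVec, Matrix.mul_nonsing_inv _ (posDef_covMat hs hd).det_pos.ne'.isUnit,
    Matrix.one_mulVec]

/-- The determinant of `A D Aᵀ + s I` in terms of the small Gram matrix `Aᵀ A`. -/
theorem det_covMat (hs : s ≠ 0) :
    (covMat s A d).det =
      s ^ Fintype.card ι * (1 + s⁻¹ • (Matrix.diagonal d * (Aᵀ * A))).det := by
  have : covMat s A d = s • (1 + A * (s⁻¹ • (Matrix.diagonal d * Aᵀ))) := by
    rw [covMat, Matrix.mul_smul, smul_add, smul_smul, mul_inv_cancel₀ hs, one_smul, add_comm,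
      Matrix.mul_assoc]
  rw [this, Matrix.det_smul, Matrix.det_one_add_mul_comm, Matrix.smul_mul, Matrix.mul_assoc]

/-- Every eigenvalue of `A D Aᵀ + s I` is at least `s`. -/
theorem pow_card_le_det_covMat (hs : 0 < s) (hd : ∀ j, 0 ≤ d j) :
    s ^ Fintype.card ι ≤ (covMat s A d).det := by
  have hP := posDef_covMat (A := A) hs hd
  rw [hP.isHermitian.det_eq_prod_eigenvalues, ← Finset.card_univ, ← Finset.prod_const]
  refine Finset.prod_le_prod (fun _ _ => hs.le) fun i _ => ?_
  have h1 := hP.isHermitian.eigenvalues_eq i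
  set w : ι → ℝ := (hP.isHermitian.eigenvectorBasis i).ofLp with hw
  rw [star_trivial, dotProduct_covMat_mulVec] at h1
  have h2 : w ⬝ᵥ w = 1 := by
    have h3 := hP.isHermitian.eigenvectorBasis.orthonormal.1 i
    have h4 := EuclideanSpace.real_norm_sq_eq (hP.isHermitian.eigenvectorBasis i)
    rw [h3] at h4
    rw [dotProduct]
    simpa [hw, sq] using h4.symm
  have h5 : 0 ≤ ∑ j, d j * (Aᵀ *ᵥ w) j ^ 2 :=
    Finset.sum_nonneg fun j _ => mul_nonneg (hd j) (sq_nonneg _)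
  rw [h2] at h1
  simp only [RCLike.re_to_real, mul_one] at h1
  simp only [RCLike.ofReal_real_eq_id, id]
  linarith

/-- The value of the quadratic form `yᵀ Σ⁻¹ y` is at most the energy
`θᵀ D⁻¹ θ + s⁻¹ ‖y - A θ‖²` of any `θ = D η`. -/
theorem quadForm_inv_covMat_le (hs : 0 < s) (hd : ∀ j, 0 ≤ d j) (η : κ → ℝ) (v : ι → ℝ) :
    (A *ᵥ (fun j => d j * η j) + v) ⬝ᵥ
        (covMat s A d)⁻¹ *ᵥ (A *ᵥ (fun j => d j * η j) + v) ≤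
      ∑ j, d j * η j ^ 2 + (v ⬝ᵥ v) / s := by
  set y := A *ᵥ (fun j => d j * η j) + v with hy
  set z := (covMat s A d)⁻¹ *ᵥ y with hz
  have h1 : covMat s A d *ᵥ z = y := covMat_mulVec_inv_mulVec hs hd y
  have h2 := dotProduct_covMat_mulVec (s := s) (A := A) (d := d) z
  rw [h1] at h2
  have h3 : z ⬝ᵥ y = ∑ j, (Aᵀ *ᵥ z) j * (d j * η j) + z ⬝ᵥ v := by
    rw [hy, dotProduct_add, dotProduct_mulVec_transpose]; rfl
  -- `yᵀ Σ⁻¹ y = 2 z·y - z·Σ z`, and each of the two parts of the right side is bounded by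
  -- completing the square
  have h4 : 2 * (z ⬝ᵥ v) - s * (z ⬝ᵥ z) ≤ (v ⬝ᵥ v) / s := by
    rw [le_div_iff₀ hs]
    have h5 : 0 ≤ (v - s • z) ⬝ᵥ (v - s • z) := 
      Finset.sum_nonneg fun i _ => mul_self_nonneg _
    simp only [sub_dotProduct, dotProduct_sub, smul_dotProduct, dotProduct_smul, smul_eq_mul] at h5
    rw [dotProduct_comm v z] at h5
    nlinarith
  have h6 : 2 * ∑ j, (Aᵀ *ᵥ z) j * (d j * η j) - ∑ j, d j * (Aᵀ *ᵥ z) j ^ 2 ≤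
      ∑ j, d j * η j ^ 2 := by
    rw [Finset.mul_sum, ← Finset.sum_sub_distrib]
    refine Finset.sum_le_sum fun j _ => ?_
    nlinarith [mul_nonneg (hd j) (sq_nonneg ((Aᵀ *ᵥ z) j - η j))]
  rw [dotProduct_comm y z]
  linarith

/-- With `y = A θ + v`, `z = Σ⁻¹ y` and `x = D Aᵀ z - θ`, the normal equations read
`A x = v - s z`. -/
theorem mulVec_residual (hs : 0 < s) (hd : ∀ j, 0 ≤ d j) (θ : κ → ℝ) (v : ι → ℝ) :
    A *ᵥ ((fun j => d j * (Aᵀ *ᵥ ((covMat s A d)⁻¹ *ᵥ (A *ᵥ θ + v))) j) - θ) =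
      v - s • ((covMat s A d)⁻¹ *ᵥ (A *ᵥ θ + v)) := by
  have h1 := covMat_mulVec_inv_mulVec (A := A) hs hd (A *ᵥ θ + v)
  rw [covMat_mulVec] at h1
  rw [Matrix.mulVec_sub]
  rw [← eq_sub_iff_add_eq] at h1
  rw [h1]
  abel

/-- A lower bound for `yᵀ Σ⁻¹ y` in terms of the estimation error `x = D Aᵀ Σ⁻¹ y - θ`. -/
theorem le_quadForm_inv_covMat (hs : 0 < s) (hd : ∀ j, 0 ≤ d j) (θ x : κ → ℝ) (v : ι → ℝ)
    (hx : x = (fun j => d j * (Aᵀ *ᵥ ((covMat s A d)⁻¹ *ᵥ (A *ᵥ θ + v))) j) - θ) :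
    (v ⬝ᵥ v - 2 * (x ⬝ᵥ Aᵀ *ᵥ v) + x ⬝ᵥ (Aᵀ * A) *ᵥ x) / s ≤
      (A *ᵥ θ + v) ⬝ᵥ (covMat s A d)⁻¹ *ᵥ (A *ᵥ θ + v) := by
  have h0 := mulVec_residual (A := A) hs hd θ v
  rw [← hx] at h0
  set y := A *ᵥ θ + v with hy
  set z := (covMat s A d)⁻¹ *ᵥ y with hz
  have h1 : covMat s A d *ᵥ z = y := covMat_mulVec_inv_mulVec hs hd y
  have h2 := dotProduct_covMat_mulVec (s := s) (A := A) (d := d) z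
  rw [h1] at h2
  have h5 : 0 ≤ ∑ j, d j * (Aᵀ *ᵥ z) j ^ 2 :=
    Finset.sum_nonneg fun j _ => mul_nonneg (hd j) (sq_nonneg _)
  have h6 : s • z = v - A *ᵥ x := by rw [h0]; abel
  have h7 : s * (s * (z ⬝ᵥ z)) = v ⬝ᵥ v - 2 * (x ⬝ᵥ Aᵀ *ᵥ v) + x ⬝ᵥ (Aᵀ * A) *ᵥ x := by
    have h8 : s * (s * (z ⬝ᵥ z)) = (s • z) ⬝ᵥ (s • z) := by
      simp only [smul_dotProduct, dotProduct_smul, smul_eq_mul]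
    rw [h8, h6]
    simp only [sub_dotProduct, dotProduct_sub]
    rw [← Matrix.mulVec_mulVec, dotProduct_mulVec_transpose Aᵀ x, dotProduct_mulVec_transpose Aᵀ x,
      Matrix.transpose_transpose, dotProduct_comm v (A *ᵥ x)]
    ring
  rw [dotProduct_comm y z, div_le_iff₀ hs]
  nlinarith

/-- The upper bound `aⱼᵀ Σ⁻¹ aⱼ ≤ 1 / dⱼ` for the `j`-th column `aⱼ` of `A`, which holds because
`Σ` dominates `dⱼ aⱼ aⱼᵀ`. -/
theorem mul_quadForm_col_le_one (hs : 0 < s) (hd : ∀ j, 0 ≤ d j) (j : κ) :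
    d j * (Aᵀ * (covMat s A d)⁻¹ * A) j j ≤ 1 := by
  set x := (covMat s A d)⁻¹ *ᵥ A.col j with hx
  have h1 : covMat s A d *ᵥ x = A.col j := covMat_mulVec_inv_mulVec hs hd _
  have h2 := dotProduct_covMat_mulVec (s := s) (A := A) (d := d) x
  have hb : (Aᵀ *ᵥ x) j = (Aᵀ * (covMat s A d)⁻¹ * A) j j := by
    rw [hx, Matrix.mulVec_mulVec]; rfl
  have hb' : x ⬝ᵥ A.col j = (Aᵀ * (covMat s A d)⁻¹ * A) j j := by
    rw [← hb, dotProduct_comm]; rfl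
  rw [h1, hb'] at h2
  rw [← hb] at h2 ⊢
  have h3 : d j * (Aᵀ *ᵥ x) j ^ 2 ≤ ∑ j, d j * (Aᵀ *ᵥ x) j ^ 2 :=
    Finset.single_le_sum (f := fun j => d j * (Aᵀ *ᵥ x) j ^ 2)
      (fun j _ => mul_nonneg (hd j) (sq_nonneg _)) (Finset.mem_univ j)
  have h4 : 0 ≤ x ⬝ᵥ x := Finset.sum_nonneg fun i _ => mul_self_nonneg _
  by_contra! h5
  have h6 : 0 < (Aᵀ *ᵥ x) j := by
    by_contra! h6
    nlinarith [mul_nonneg (hd j) (neg_nonneg.2 h6)]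
  nlinarith [mul_nonneg hs.le h4]

/-- If `ζ` picks out the `j`-th column of `A`, the Cauchy-Schwarz inequality for `Σ` bounds
`aⱼᵀ Σ⁻¹ aⱼ` from below. -/
theorem one_le_quadForm_col_mul (hs : 0 < s) (hd : ∀ j, 0 ≤ d j) (j : κ) (ζ : ι → ℝ)
    (hζ : Aᵀ *ᵥ ζ = Pi.single j 1) :
    1 ≤ (Aᵀ * (covMat s A d)⁻¹ * A) j j * (d j + s * (ζ ⬝ᵥ ζ)) := by
  have hP := posDef_covMat (A := A) hs hd
  set x := (covMat s A d)⁻¹ *ᵥ A.col j with hx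
  have h1 : covMat s A d *ᵥ x = A.col j := covMat_mulVec_inv_mulVec hs hd _
  have hb : x ⬝ᵥ A.col j = (Aᵀ * (covMat s A d)⁻¹ * A) j j := by
    have h2 : (Aᵀ *ᵥ x) j = (Aᵀ * (covMat s A d)⁻¹ * A) j j := by
      rw [hx, Matrix.mulVec_mulVec]; rfl
    rw [← h2, dotProduct_comm]; rfl
  have hq : ζ ⬝ᵥ covMat s A d *ᵥ ζ = d j + s * (ζ ⬝ᵥ ζ) := by
    rw [dotProduct_covMat_mulVec, hζ]
    simp [Pi.single_apply]
  have ha : ζ ⬝ᵥ A.col j = 1 := by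
    have := congrFun hζ j
    rw [Pi.single_eq_same] at this
    rw [← this, dotProduct_comm]; rfl
  have ha' : x ⬝ᵥ covMat s A d *ᵥ ζ = 1 := by
    rw [dotProduct_mulVec_transpose, covMat_transpose, h1, dotProduct_comm, ha]
  have hq0 : 0 < d j + s * (ζ ⬝ᵥ ζ) := by
    have hne : ζ ≠ 0 := by
      rintro rfl
      simp at ha
    have h2 : 0 < ζ ⬝ᵥ ζ := by simpa using Matrix.dotProduct_star_self_pos_iff.2 hne
    have := hd j
    positivity
  set q := d j + s * (ζ ⬝ᵥ ζ)
  -- the multiple of `x` is chosen so that the expanded form factors as `q * (q * b - 1)`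
  have h3 := hP.posSemidef.dotProduct_mulVec_nonneg (ζ - q • x)
  rw [star_trivial, Matrix.mulVec_sub, Matrix.mulVec_smul, h1] at h3
  simp only [sub_dotProduct, dotProduct_sub, smul_dotProduct, dotProduct_smul, smul_eq_mul,
    ha, ha', hq, hb] at h3
  by_contra! h4
  nlinarith

end CovMatrix

/-! ### First variation of the log determinant and of the inverse quadratic form -/

section Derivatives

variable {ι : Type*} [Fintype ι] [DecidableEq ι]

theorem hasDerivAt_log_det_add_smul {M : Matrix ι ι ℝ} (hM : 0 < M.det) (D : Matrix ι ι ℝ) :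
    HasDerivAt (fun h : ℝ => Real.log (M + h • D).det) (M⁻¹ * D).trace 0 := by
  have hu : IsUnit M.det := hM.ne'.isUnit
  -- the expansion of the determinant to first order in `h`
  obtain ⟨f, hf⟩ : ∃ f : Polynomial ℝ, ∀ h : ℝ, (1 + h • (M⁻¹ * D)).det =
      1 + (M⁻¹ * D).trace * h + f.eval h * h ^ 2 :=
    ⟨_, fun h => Matrix.det_one_add_smul h (M⁻¹ * D)⟩
  have h1 : ∀ h : ℝ, (M + h • D).det =
      M.det * (1 + (M⁻¹ * D).trace * h + f.eval h * h ^ 2) := by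
    intro h
    rw [← hf, ← Matrix.det_mul, mul_add, mul_one, Matrix.mul_smul,
      Matrix.mul_nonsing_inv_cancel_left _ _ hu]
  have h2 : HasDerivAt (fun h : ℝ => (M + h • D).det) (M.det * (M⁻¹ * D).trace) 0 := by
    simp_rw [h1]
    have h3 := ((((hasDerivAt_id (0 : ℝ)).const_mul (M⁻¹ * D).trace).const_add 1).add
      ((f.hasDerivAt 0).mul (hasDerivAt_pow 2 (0 : ℝ)))).const_mul M.det
    refine h3.congr_deriv ?_
    simp
  have h4 := h2.log (by simpa using hM.ne')
  refine h4.congr_deriv ?_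
  simp only [zero_smul, add_zero]
  field_simp

open scoped Matrix.Norms.Operator in
theorem hasDerivAt_quadForm_inv_add_smul {M : Matrix ι ι ℝ} (hM : IsUnit M) (hMt : Mᵀ = M)
    (D : Matrix ι ι ℝ) (y : ι → ℝ) :
    HasDerivAt (fun h : ℝ => y ⬝ᵥ (M + h • D)⁻¹ *ᵥ y)
      (-((M⁻¹ *ᵥ y) ⬝ᵥ D *ᵥ (M⁻¹ *ᵥ y))) 0 := by
  obtain ⟨U, rfl⟩ := hM
  have h1 : HasDerivAt (fun h : ℝ => (U : Matrix ι ι ℝ) + h • D) D 0 := by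
    exact (((hasDerivAt_id (0 : ℝ)).smul_const D).const_add (U : Matrix ι ι ℝ)).congr_deriv
      (one_smul _ _)
  have h2 := hasFDerivAt_ringInverse (𝕜 := ℝ) U
  have h3 := HasFDerivAt.comp_hasDerivAt_of_eq (0 : ℝ) h2 h1 (by simp)
  let L : Matrix ι ι ℝ →ₗ[ℝ] ℝ :=
    { toFun := fun B => y ⬝ᵥ B *ᵥ y
      map_add' := fun B C => by rw [Matrix.add_mulVec, dotProduct_add]
      map_smul' := fun c B => by rw [Matrix.smul_mulVec, dotProduct_smul]; rfl }
  have h4 := (LinearMap.toContinuousLinearMap L).hasFDerivAt.comp_hasDerivAt (0 : ℝ) h3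
  refine HasDerivAt.congr_deriv (f' := _) (h4.congr_of_eventuallyEq ?_) ?_
  · refine Eventually.of_forall fun h => ?_
    simp [L, Matrix.nonsing_inv_eq_ringInverse]
  · have h5 : ((U⁻¹ : (Matrix ι ι ℝ)ˣ) : Matrix ι ι ℝ) = (U : Matrix ι ι ℝ)⁻¹ := by
      rw [Matrix.coe_units_inv]
    have h6 : ((U : Matrix ι ι ℝ)⁻¹)ᵀ = (U : Matrix ι ι ℝ)⁻¹ := by
      rw [Matrix.transpose_nonsing_inv, hMt]
    change y ⬝ᵥ (-(((U⁻¹ : (Matrix ι ι ℝ)ˣ) : Matrix ι ι ℝ) * D *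
      ((U⁻¹ : (Matrix ι ι ℝ)ˣ) : Matrix ι ι ℝ))) *ᵥ y = _
    rw [h5]
    rw [Matrix.neg_mulVec, dotProduct_neg, ← Matrix.mulVec_mulVec, ← Matrix.mulVec_mulVec,
      dotProduct_mulVec_transpose, h6]

end Derivatives

/-! ### The feasible set and the existence of minimizers -/

theorem lqNorm_mono {p : ℕ} (q : ℝ≥0∞) [hq : Fact (1 ≤ q)] {l l' : Fin p → ℝ}
    (h0 : ∀ i, 0 ≤ l i) (h : ∀ i, l i ≤ l' i) : lqNorm q l ≤ lqNorm q l' := by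
  have habs : ∀ i, ‖l i‖ ≤ ‖l' i‖ := fun i => by
    rw [Real.norm_of_nonneg (h0 i), Real.norm_of_nonneg ((h0 i).trans (h i))]
    exact h i
  rcases eq_or_ne q ∞ with rfl | hq'
  · rw [lqNorm, lqNorm, PiLp.norm_eq_ciSup, PiLp.norm_eq_ciSup]
    exact ciSup_mono (Finite.bddAbove_range _) habs
  · have hpos : 0 < q.toReal := ENNReal.toReal_pos (zero_lt_one.trans_le hq.out).ne' hq'
    rw [lqNorm, lqNorm, PiLp.norm_eq_sum hpos, PiLp.norm_eq_sum hpos]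
    refine Real.rpow_le_rpow (Finset.sum_nonneg fun i _ => by positivity) ?_ (by positivity)
    exact Finset.sum_le_sum fun i _ =>
      Real.rpow_le_rpow (norm_nonneg _) (habs i) hpos.le

theorem continuous_lqNorm {p : ℕ} (q : ℝ≥0∞) [Fact (1 ≤ q)] :
    Continuous (lqNorm q : (Fin p → ℝ) → ℝ) :=
  continuous_norm.comp (PiLp.continuous_toLp q _)

theorem isCompact_feasible (p : ℕ) (q : ℝ≥0∞) [Fact (1 ≤ q)] (R : ℝ) :
    IsCompact (feasible p q R) := by
  have h1 : IsCompact {l : Fin p → ℝ | lqNorm q l ≤ R} := by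
    have h2 := (isCompact_closedBall (0 : PiLp q fun _ : Fin p => ℝ) R).image
      (PiLp.continuous_ofLp q _)
    convert h2 using 1
    ext l
    simp only [Set.mem_ofPred_eq, Set.mem_image, Metric.mem_closedBall, dist_zero_right, lqNorm]
    exact ⟨fun h => ⟨_, h, rfl⟩, by rintro ⟨x, hx, rfl⟩; exact hx⟩
  have h3 : IsClosed {l : Fin p → ℝ | ∀ i, 0 ≤ l i} := by
    rw [Set.ofPred_forall]
    exact isClosed_iInter fun i => isClosed_le continuous_const (continuous_apply i)
  exact h1.inter_right h3

section Objective

variable {p n : ℕ} {k : Fin p → ℕ} {σ γ : ℝ} {G : Fin n → Idx k → ℝ}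

theorem sigmaY_eq_covMat (σ : ℝ) (G : Fin n → Idx k → ℝ) (l : Fin p → ℝ) :
    sigmaY σ G l = covMat (σ ^ 2) (Matrix.of G) (fun s => l s.1) := rfl

theorem posDef_sigmaY (hσ : 0 < σ) (G : Fin n → Idx k → ℝ) {l : Fin p → ℝ}
    (hl : ∀ i, 0 ≤ l i) : (sigmaY σ G l).PosDef :=
  posDef_covMat (A := Matrix.of G) (d := fun s => l s.1) (pow_pos hσ 2) fun s => hl s.1

theorem continuousOn_objective (hσ : 0 < σ) (γ : ℝ) (G : Fin n → Idx k → ℝ) (y : Fin n → ℝ) :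
    ContinuousOn (objective σ γ G y) {l | ∀ i, 0 ≤ l i} := by
  have hS : Continuous fun l => sigmaY σ G l :=
    (continuous_covMat (σ ^ 2) (Matrix.of G)).comp (continuous_pi fun s => continuous_apply s.1)
  have hdet : ∀ l ∈ {l : Fin p → ℝ | ∀ i, 0 ≤ l i}, (sigmaY σ G l).det ≠ 0 := fun l hl =>
    (posDef_sigmaY hσ G hl).det_pos.ne'
  have hinv : ContinuousOn (fun l => (sigmaY σ G l)⁻¹) {l | ∀ i, 0 ≤ l i} := by
    simp_rw [Matrix.inv_def, Ring.inverse_eq_inv']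
    exact (hS.matrix_det.continuousOn.inv₀ hdet).smul hS.matrix_adjugate.continuousOn
  have hlin : Continuous fun B : Matrix (Fin n) (Fin n) ℝ => y ⬝ᵥ B *ᵥ y :=
    continuous_const.dotProduct (continuous_id.matrix_mulVec continuous_const)
  have h1 : ContinuousOn (fun l => y ⬝ᵥ (sigmaY σ G l)⁻¹ *ᵥ y) {l | ∀ i, 0 ≤ l i} :=
    hlin.comp_continuousOn hinv
  have h2 : ContinuousOn (fun l => Real.log (sigmaY σ G l).det) {l | ∀ i, 0 ≤ l i} :=
    hS.matrix_det.continuousOn.log hdet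
  have h3 : Continuous fun l : Fin p → ℝ => γ * ∑ i, l i := by fun_prop
  exact ((h2.const_mul (1 / 2)).add (h1.const_mul (1 / 2))).add h3.continuousOn

theorem exists_isEstimate (hσ : 0 < σ) (γ : ℝ) (G : Fin n → Idx k → ℝ) (y : Fin n → ℝ)
    (q : ℝ≥0∞) [Fact (1 ≤ q)] {R : ℝ} (hne : (feasible p q R).Nonempty) :
    ∃ l, IsEstimate q R σ γ G y l :=
  (isCompact_feasible p q R).exists_isMinOn hne
    ((continuousOn_objective hσ γ G y).mono fun _ hl => hl.2)

/-! ### First order conditions -/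

/-- The partial derivative of the objective with respect to `λᵢ`, in closed form
(see `hasDerivAt_objective`). -/
noncomputable def score (σ γ : ℝ) (G : Fin n → Idx k → ℝ) (y : Fin n → ℝ)
    (l : Fin p → ℝ) (i : Fin p) : ℝ :=
  1 / 2 * ∑ a, ((Matrix.of G)ᵀ * (sigmaY σ G l)⁻¹ * Matrix.of G) ⟨i, a⟩ ⟨i, a⟩ -
    1 / 2 * ∑ a, ((Matrix.of G)ᵀ *ᵥ ((sigmaY σ G l)⁻¹ *ᵥ y)) ⟨i, a⟩ ^ 2 + γ

theorem sum_single_mul (i : Fin p) (f : Idx k → ℝ) :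
    ∑ s : Idx k, (Pi.single i (1 : ℝ) : Fin p → ℝ) s.1 * f s = ∑ a, f ⟨i, a⟩ := by
  rw [Fintype.sum_sigma, Finset.sum_eq_single i]
  · simp
  · intro j _ hj
    simp [Pi.single_eq_of_ne hj]
  · simp

theorem hasDerivAt_objective (hσ : 0 < σ) (γ : ℝ) (G : Fin n → Idx k → ℝ) (y : Fin n → ℝ)
    {l : Fin p → ℝ} (hl : ∀ i, 0 ≤ l i) (i : Fin p) :
    HasDerivAt (fun h : ℝ => objective σ γ G y (l + h • (Pi.single i 1 : Fin p → ℝ)))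
      (score σ γ G y l i) 0 := by
  set A := Matrix.of G with hA
  set D : Matrix (Fin n) (Fin n) ℝ :=
    A * Matrix.diagonal (fun s : Idx k => (Pi.single i (1 : ℝ) : Fin p → ℝ) s.1) * Aᵀ with hD
  have hP : (sigmaY σ G l).PosDef := posDef_sigmaY hσ G hl
  have hS : ∀ h : ℝ, sigmaY σ G (l + h • (Pi.single i 1 : Fin p → ℝ)) = sigmaY σ G l + h • D := by
    intro h
    have h1 : blockLambda k (l + h • (Pi.single i 1 : Fin p → ℝ)) = blockLambda k l +
        h • Matrix.diagonal (fun s : Idx k => (Pi.single i (1 : ℝ) : Fin p → ℝ) s.1) := by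
      rw [blockLambda, blockLambda, ← Matrix.diagonal_smul, Matrix.diagonal_add]
      rfl
    rw [sigmaY, sigmaY, h1, Matrix.mul_add, Matrix.add_mul, Matrix.mul_smul,
      Matrix.smul_mul, hD, hA]
    abel
  have h1 := hasDerivAt_log_det_add_smul hP.det_pos D
  have h2 := hasDerivAt_quadForm_inv_add_smul hP.isUnit covMat_transpose D y
  have h3 : HasDerivAt (fun h : ℝ => ∑ j, (l + h • (Pi.single i 1 : Fin p → ℝ)) j) 1 0 := by
    have h4 : ∀ h : ℝ, ∑ j, (l + h • (Pi.single i 1 : Fin p → ℝ)) j = ∑ j, l j + h := fun h => by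
      simp [Finset.sum_add_distrib, ← Finset.mul_sum]
    simp_rw [h4]
    exact (hasDerivAt_id (0 : ℝ)).const_add _
  have h5 := ((h1.const_mul (1 / 2)).add (h2.const_mul (1 / 2))).add (h3.const_mul γ)
  refine HasDerivAt.congr_deriv (h5.congr_of_eventuallyEq (Eventually.of_forall fun h => ?_)) ?_
  · simp only [objective, hS]
    rfl
  · have h6 : ((sigmaY σ G l)⁻¹ * D).trace =
        ∑ a, (Aᵀ * (sigmaY σ G l)⁻¹ * A) ⟨i, a⟩ ⟨i, a⟩ := by
      simp only [Matrix.mul_assoc Aᵀ]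
      rw [hD, Matrix.trace_mul_comm, Matrix.mul_assoc, Matrix.mul_assoc, Matrix.trace_mul_comm,
        Matrix.mul_assoc, Matrix.trace]
      refine Eq.trans ?_
        (sum_single_mul i fun s => (Aᵀ * ((sigmaY σ G l)⁻¹ * A)) s s)
      exact Finset.sum_congr rfl fun s _ => by
        rw [Matrix.diag_apply, Matrix.diagonal_mul, Matrix.mul_assoc Aᵀ]
    have h7 : ∀ z : Fin n → ℝ, z ⬝ᵥ D *ᵥ z = ∑ a, (Aᵀ *ᵥ z) ⟨i, a⟩ ^ 2 := by
      intro z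
      have h8 := dotProduct_covMat_mulVec (s := 0) (A := A)
        (d := fun s : Idx k => (Pi.single i (1 : ℝ) : Fin p → ℝ) s.1) z
      rw [covMat, zero_smul, add_zero, zero_mul, add_zero, sum_single_mul] at h8
      exact h8
    rw [h6, h7, score]
    ring

variable {q : ℝ≥0∞} [Fact (1 ≤ q)] {R : ℝ} {y : Fin n → ℝ} {l : Fin p → ℝ}

theorem IsEstimate.score_nonpos (hσ : 0 < σ) (hE : IsEstimate q R σ γ G y l) {i : Fin p}
    (hi : 0 < l i) : score σ γ G y l i ≤ 0 := by
  have h1 := (hasDerivAt_objective hσ γ G y hE.1.2 i).tendsto_slope_zero_left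
  refine le_of_tendsto h1 ?_
  have h2 : ∀ᶠ h : ℝ in 𝓝[<] 0, -l i < h :=
    (lt_mem_nhds (by linarith : -l i < 0)).filter_mono nhdsWithin_le_nhds
  filter_upwards [h2, self_mem_nhdsWithin] with h hh hneg
  have hneg' : h < 0 := hneg
  -- decreasing one coordinate does not leave the feasible set
  have hf : l + h • (Pi.single i 1 : Fin p → ℝ) ∈ feasible p q R := by
    have hn : ∀ j, 0 ≤ (l + h • (Pi.single i 1 : Fin p → ℝ)) j := by
      intro j
      rcases eq_or_ne j i with rfl | hj
      · simp; linarith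
      · simp [hj, hE.1.2 j]
    refine ⟨(lqNorm_mono q hn fun j => ?_).trans hE.1.1, hn⟩
    rcases eq_or_ne j i with rfl | hj
    · simp; linarith
    · simp [hj]
  have h3 : objective σ γ G y l ≤ _ := hE.2 hf
  simp only [zero_add, zero_smul, add_zero, smul_eq_mul]
  exact mul_nonpos_of_nonpos_of_nonneg (inv_nonpos.2 hneg'.le) (sub_nonneg.2 h3)

theorem IsEstimate.score_nonneg (hσ : 0 < σ) (hE : IsEstimate q R σ γ G y l)
    (hR : lqNorm q l < R) (i : Fin p) : 0 ≤ score σ γ G y l i := by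
  have h1 := (hasDerivAt_objective hσ γ G y hE.1.2 i).tendsto_slope_zero_right
  refine ge_of_tendsto h1 ?_
  have hc : Continuous fun h : ℝ => lqNorm q (l + h • (Pi.single i 1 : Fin p → ℝ)) :=
    (continuous_lqNorm q).comp (by fun_prop)
  have h2 : ∀ᶠ h : ℝ in 𝓝[>] 0, lqNorm q (l + h • (Pi.single i 1 : Fin p → ℝ)) < R :=
    (hc.tendsto 0 |>.eventually (gt_mem_nhds (by simpa using hR))).filter_mono nhdsWithin_le_nhds
  filter_upwards [h2, self_mem_nhdsWithin] with h hh hpos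
  have hpos' : 0 < h := hpos
  have hf : l + h • (Pi.single i 1 : Fin p → ℝ) ∈ feasible p q R := by
    refine ⟨hh.le, fun j => ?_⟩
    have h4 : (0 : ℝ) ≤ (Pi.single i (1 : ℝ) : Fin p → ℝ) j :=
      (Pi.single_nonneg.2 zero_le_one : (0 : Fin p → ℝ) ≤ Pi.single i 1) j
    have := hE.1.2 j
    simp only [Pi.add_apply, Pi.smul_apply, smul_eq_mul]
    positivity
  have h3 : objective σ γ G y l ≤ _ := hE.2 hf
  simp only [zero_add, zero_smul, add_zero, smul_eq_mul]
  exact mul_nonneg (inv_nonneg.2 hpos'.le) (sub_nonneg.2 h3)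

/-! ### Consequences of optimality for a fixed sample -/

/-- The error `Λ Gᵀ Σ_y(λ)⁻¹ y - θ` of the posterior mean of `θ` given `y` and `λ`. -/
noncomputable def posteriorError (σ : ℝ) (θ : (i : Fin p) → EuclideanSpace ℝ (Fin (k i)))
    (G : Fin n → Idx k → ℝ) (v : Fin n → ℝ) (l : Fin p → ℝ) : Idx k → ℝ :=
  (fun s => l s.1 * ((Matrix.of G)ᵀ *ᵥ ((sigmaY σ G l)⁻¹ *ᵥ observation θ G v)) s) - stack θ

variable {θ : (i : Fin p) → EuclideanSpace ℝ (Fin (k i))} {v : Fin n → ℝ}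

/-- The blockwise identity `λᵢ u⁽ⁱ⁾ = θ⁽ⁱ⁾ + x⁽ⁱ⁾` for `u = Gᵀ Σ_y(λ)⁻¹ y` and the posterior error
`x`, in the form in which it enters the first order conditions. -/
theorem sq_mul_sum_sq_eq (i : Fin p) :
    l i ^ 2 * ∑ a, ((Matrix.of G)ᵀ *ᵥ ((sigmaY σ G l)⁻¹ *ᵥ observation θ G v)) ⟨i, a⟩ ^ 2 =
      ∑ a, (θ i a + posteriorError σ θ G v l ⟨i, a⟩) ^ 2 := by
  rw [Finset.mul_sum]
  refine Finset.sum_congr rfl fun a _ => ?_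
  simp only [posteriorError, Pi.sub_apply, stack]
  ring

/-- If the Gram matrix is bounded below by `c I`, then the `j`-th coordinate functional factors
through `Aᵀ` with a vector of squared length at most `1 / c`. -/
theorem exists_transpose_mulVec_eq_single {ι κ : Type*} [Fintype ι] [Fintype κ] [DecidableEq κ]
    {A : Matrix ι κ ℝ} {c : ℝ} (hc : 0 < c) (hA : ∀ x, c * (x ⬝ᵥ x) ≤ x ⬝ᵥ (Aᵀ * A) *ᵥ x)
    (j : κ) : ∃ ζ : ι → ℝ, Aᵀ *ᵥ ζ = Pi.single j 1 ∧ ζ ⬝ᵥ ζ ≤ 1 / c := by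
  have hP : (Aᵀ * A).PosDef := by
    refine Matrix.PosDef.of_dotProduct_mulVec_pos ?_ fun x hx => ?_
    · rw [Matrix.IsHermitian, Matrix.conjTranspose_eq_transpose_of_trivial,
        Matrix.transpose_mul, Matrix.transpose_transpose]
    · have h2 : 0 < x ⬝ᵥ x := by simpa using Matrix.dotProduct_star_self_pos_iff.2 hx
      rw [star_trivial]
      exact (mul_pos hc h2).trans_le (hA x)
  set β := (Aᵀ * A)⁻¹ *ᵥ (Pi.single j 1 : κ → ℝ) with hβ
  have h1 : (Aᵀ * A) *ᵥ β = Pi.single j 1 := by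
    rw [hβ, Matrix.mulVec_mulVec, Matrix.mul_nonsing_inv _ hP.det_pos.ne'.isUnit,
      Matrix.one_mulVec]
  refine ⟨A *ᵥ β, by rw [Matrix.mulVec_mulVec, h1], ?_⟩
  have h2 : A *ᵥ β ⬝ᵥ A *ᵥ β = β j := by
    rw [dotProduct_mulVec_transpose, Matrix.mulVec_mulVec, h1]
    simp
  have h3 := hA β
  rw [h1, dotProduct_single, mul_one] at h3
  have h4 : β j ^ 2 ≤ β ⬝ᵥ β := by
    rw [sq]
    exact Finset.single_le_sum (f := fun i => β i * β i) (fun i _ => mul_self_nonneg _)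
      (Finset.mem_univ j)
  rw [h2, le_div_iff₀ hc]
  have h5 : c * β j ^ 2 ≤ β j := (mul_le_mul_of_nonneg_left h4 hc.le).trans h3
  by_contra! h6
  have h7 : 0 < β j := by
    by_contra! h7
    nlinarith
  nlinarith

/-- The stationarity inequality obtained by decreasing `λᵢ`; it is the derivative condition
multiplied by `λᵢ²`, so that it also holds when `λᵢ = 0`. -/
theorem IsEstimate.le_sum_sq (hσ : 0 < σ) (hE : IsEstimate q R σ γ G (observation θ G v) l)
    {c : ℝ} (hc : 0 < c)
    (hG : ∀ x, c * (x ⬝ᵥ x) ≤ x ⬝ᵥ ((Matrix.of G)ᵀ * Matrix.of G) *ᵥ x) (i : Fin p) :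
    k i * l i + 2 * γ * l i ^ 2 ≤
      ∑ a, (θ i a + posteriorError σ θ G v l ⟨i, a⟩) ^ 2 + k i * (σ ^ 2 / c) := by
  have hs : 0 < σ ^ 2 := pow_pos hσ 2
  rcases (hE.1.2 i).eq_or_lt with h0 | hpos
  · rw [← h0]
    have h1 : 0 ≤ ∑ a, (θ i a + posteriorError σ θ G v l ⟨i, a⟩) ^ 2 :=
      Finset.sum_nonneg fun a _ => sq_nonneg _
    have h2 : 0 ≤ k i * (σ ^ 2 / c) := by positivity
    linarith
  · have h1 := hE.score_nonpos hσ hpos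
    rw [score] at h1
    have h2 : (k i : ℝ) * (l i - σ ^ 2 / c) ≤ l i ^ 2 *
        ∑ a, ((Matrix.of G)ᵀ * (sigmaY σ G l)⁻¹ * Matrix.of G) ⟨i, a⟩ ⟨i, a⟩ := by
      rw [Finset.mul_sum]
      have h3 : ∀ a ∈ (Finset.univ : Finset (Fin (k i))), l i - σ ^ 2 / c ≤ l i ^ 2 *
          ((Matrix.of G)ᵀ * (sigmaY σ G l)⁻¹ * Matrix.of G) ⟨i, a⟩ ⟨i, a⟩ := by
        intro a _
        obtain ⟨ζ, hζ, hζc⟩ := exists_transpose_mulVec_eq_single hc hG ⟨i, a⟩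
        have h4 := one_le_quadForm_col_mul (A := Matrix.of G) hs (fun s => hE.1.2 s.1) ⟨i, a⟩ ζ hζ
        rw [← sigmaY_eq_covMat] at h4
        set b := ((Matrix.of G)ᵀ * (sigmaY σ G l)⁻¹ * Matrix.of G) ⟨i, a⟩ ⟨i, a⟩
        have h5 : σ ^ 2 * (ζ ⬝ᵥ ζ) ≤ σ ^ 2 / c := by
          rw [div_eq_mul_one_div]
          exact mul_le_mul_of_nonneg_left hζc hs.le
        have h6 : 0 ≤ σ ^ 2 * (ζ ⬝ᵥ ζ) :=
          mul_nonneg hs.le (Finset.sum_nonneg fun i _ => mul_self_nonneg _)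
        change 1 ≤ b * (l i + σ ^ 2 * (ζ ⬝ᵥ ζ)) at h4
        set e := σ ^ 2 * (ζ ⬝ᵥ ζ)
        -- `λ² b ≥ λ² / (λ + e) ≥ λ - e`
        have h7 : l i - e ≤ l i ^ 2 * b := by
          have h8 : 0 < l i + e := by linarith
          rw [← mul_le_mul_iff_left₀ h8]
          nlinarith [mul_le_mul_of_nonneg_left h4 (sq_nonneg (l i)), sq_nonneg e]
        linarith
      have h9 := Finset.card_nsmul_le_sum _ _ _ h3
      simpa using h9
    have h3 := mul_le_mul_of_nonneg_left h1 (sq_nonneg (l i))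
    rw [← sq_mul_sum_sq_eq]
    nlinarith

/-- The stationarity inequality obtained by increasing `λᵢ`, which is admissible strictly inside
the ball. -/
theorem IsEstimate.sum_sq_le (hσ : 0 < σ)
    (hE : IsEstimate q R σ γ G (observation θ G v) l) (hR : lqNorm q l < R) (i : Fin p) :
    ∑ a, (θ i a + posteriorError σ θ G v l ⟨i, a⟩) ^ 2 ≤ k i * l i + 2 * γ * l i ^ 2 := by
  have h1 := hE.score_nonneg hσ hR i
  rw [score] at h1
  have h0 := hE.1.2 i
  have h2 : l i * ∑ a, ((Matrix.of G)ᵀ * (sigmaY σ G l)⁻¹ * Matrix.of G) ⟨i, a⟩ ⟨i, a⟩ ≤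
      k i := by
    rw [Finset.mul_sum]
    have h3 := Finset.sum_le_card_nsmul (Finset.univ : Finset (Fin (k i))) (fun a => l i *
      ((Matrix.of G)ᵀ * (sigmaY σ G l)⁻¹ * Matrix.of G) ⟨i, a⟩ ⟨i, a⟩) 1 fun a _ =>
        mul_quadForm_col_le_one (A := Matrix.of G) (pow_pos hσ 2)
          (fun s => hE.1.2 s.1) ⟨i, a⟩
    simpa using h3
  have h3 := mul_le_mul_of_nonneg_left h1 (sq_nonneg (l i))
  have h4 := mul_le_mul_of_nonneg_left h2 h0
  rw [← sq_mul_sum_sq_eq]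
  nlinarith

/-- Comparing the objective at the estimate and at `t = (‖θ⁽ⁱ⁾‖² / kᵢ)ᵢ` bounds the prediction
error of the posterior mean; the constants `½ ‖v‖² / σ²` and `n log σ` cancel. -/
theorem IsEstimate.energy_le (hσ : 0 < σ) (hγ : 0 ≤ γ) (hk : ∀ i, 0 < k i)
    (hE : IsEstimate q R σ γ G (observation θ G v) l)
    (hR : lqNorm q (fun i => ‖θ i‖ ^ 2 / (k i : ℝ)) ≤ R) :
    posteriorError σ θ G v l ⬝ᵥ
          ((Matrix.of G)ᵀ * Matrix.of G) *ᵥ posteriorError σ θ G v l -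
        2 * (posteriorError σ θ G v l ⬝ᵥ (Matrix.of G)ᵀ *ᵥ v) ≤
      σ ^ 2 * (∑ i, (k i : ℝ) + 2 * γ * ∑ i, ‖θ i‖ ^ 2 / (k i : ℝ) +
        Real.log (1 + (σ ^ 2)⁻¹ • (Matrix.diagonal (fun s : Idx k => ‖θ s.1‖ ^ 2 / (k s.1 : ℝ)) *
          ((Matrix.of G)ᵀ * Matrix.of G))).det) := by
  have hs : 0 < σ ^ 2 := pow_pos hσ 2
  set A := Matrix.of G with hA
  set t : Fin p → ℝ := fun i => ‖θ i‖ ^ 2 / (k i : ℝ) with ht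
  have ht0 : ∀ i, 0 ≤ t i := fun i => by positivity
  have hmin : objective σ γ G (observation θ G v) l ≤ objective σ γ G (observation θ G v) t :=
    hE.2 (show t ∈ feasible p q R from ⟨hR, ht0⟩)
  -- the lower bound at the estimate
  have h1 := le_quadForm_inv_covMat (A := A) (d := fun s : Idx k => l s.1) hs
    (fun s => hE.1.2 s.1) (stack θ) (posteriorError σ θ G v l) v rfl
  -- `θ = Λ(t) η` with `η⁽ⁱ⁾ = kᵢ θ⁽ⁱ⁾ / ‖θ⁽ⁱ⁾‖²`, which is `0` when `θ⁽ⁱ⁾ = 0`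
  have hη : (fun s : Idx k => t s.1 * (θ s.1 s.2 / t s.1)) = stack θ := by
    ext ⟨i, a⟩
    rcases eq_or_ne (θ i) 0 with h | h
    · simp [ht, h, stack]
    · have : t i ≠ 0 := by
        have := hk i
        have := norm_pos_iff.2 h
        simp only [ht]
        positivity
      simp only [stack]
      field_simp
  have h2 := quadForm_inv_covMat_le (A := A) (d := fun s : Idx k => t s.1) hs
    (fun s => ht0 s.1) (fun s => θ s.1 s.2 / t s.1) v
  rw [hη] at h2
  have h3 : ∑ s : Idx k, t s.1 * (θ s.1 s.2 / t s.1) ^ 2 ≤ ∑ i, (k i : ℝ) := by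
    rw [Fintype.sum_sigma]
    refine Finset.sum_le_sum fun i _ => ?_
    rcases (ht0 i).eq_or_lt with h | h
    · simp [← h]
    · have h4 : ∑ a, t i * (θ i a / t i) ^ 2 = ‖θ i‖ ^ 2 / t i := by
        rw [EuclideanSpace.real_norm_sq_eq, Finset.sum_div]
        exact Finset.sum_congr rfl fun a _ => by field_simp
      rw [h4, div_le_iff₀ h]
      have := hk i
      simp only [ht]
      rw [mul_div_cancel₀]
      positivity
  have h5 : Real.log (sigmaY σ G t).det - Real.log (sigmaY σ G l).det ≤
      Real.log (1 + (σ ^ 2)⁻¹ • (Matrix.diagonal (fun s : Idx k => t s.1) * (Aᵀ * A))).det := by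
    have h6 := pow_card_le_det_covMat (A := A) (d := fun s : Idx k => l s.1) hs
      fun s => hE.1.2 s.1
    have h7 := det_covMat (A := A) (d := fun s : Idx k => t s.1) hs.ne'
    have h8 := (posDef_covMat (A := A) (d := fun s : Idx k => t s.1) hs fun s => ht0 s.1).det_pos
    have hpow : 0 < (σ ^ 2) ^ Fintype.card (Fin n) := pow_pos hs _
    have h9 := Real.log_le_log hpow h6
    rw [h7] at h8
    rw [sigmaY_eq_covMat, sigmaY_eq_covMat, h7,
      Real.log_mul hpow.ne' (pos_of_mul_pos_right h8 hpow.le).ne']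
    linarith
  have hl0 : 0 ≤ ∑ i, l i := Finset.sum_nonneg fun i _ => hE.1.2 i
  simp only [objective] at hmin
  change _ ≤ (observation θ G v) ⬝ᵥ (sigmaY σ G l)⁻¹ *ᵥ (observation θ G v) at h1
  change (observation θ G v) ⬝ᵥ (sigmaY σ G t)⁻¹ *ᵥ (observation θ G v) ≤ _ at h2
  have h10 := mul_nonneg hγ hl0
  have h11 : (v ⬝ᵥ v - 2 * (posteriorError σ θ G v l ⬝ᵥ Aᵀ *ᵥ v) +
      posteriorError σ θ G v l ⬝ᵥ (Aᵀ * A) *ᵥ posteriorError σ θ G v l) / σ ^ 2 ≤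
      ∑ i, (k i : ℝ) + 2 * γ * ∑ i, t i + Real.log (1 + (σ ^ 2)⁻¹ •
        (Matrix.diagonal (fun s : Idx k => t s.1) * (Aᵀ * A))).det + (v ⬝ᵥ v) / σ ^ 2 := by
    linarith
  rw [div_le_iff₀ hs, add_mul, div_mul_cancel₀ _ hs.ne'] at h11
  linarith

end Objective

/-! ### Asymptotics along a deterministic sequence of samples -/

section Perturbation

variable {κ : Type*} [Fintype κ]

theorem exists_pos_mul_le_of_posDef {Ψ : Matrix κ κ ℝ} (hΨ : Ψ.PosDef) :
    ∃ c : ℝ, 0 < c ∧ ∀ x : κ → ℝ, c * (x ⬝ᵥ x) ≤ x ⬝ᵥ Ψ *ᵥ x := by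
  rcases isEmpty_or_nonempty κ with hκ | hκ
  · exact ⟨1, one_pos, fun x => by simp [dotProduct]⟩
  have hcont : Continuous fun x : EuclideanSpace ℝ κ => x.ofLp ⬝ᵥ Ψ *ᵥ x.ofLp := by
    have h1 : Continuous fun x : EuclideanSpace ℝ κ => x.ofLp := PiLp.continuous_ofLp 2 _
    exact h1.dotProduct (continuous_const.matrix_mulVec h1)
  obtain ⟨u, hu, hmin⟩ := (isCompact_sphere (0 : EuclideanSpace ℝ κ) 1).exists_isMinOn
    (NormedSpace.sphere_nonempty.2 zero_le_one) hcont.continuousOn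
  have hu0 : u.ofLp ≠ 0 := by
    intro h
    have h2 : u = 0 := by ext i; simp [h]
    rw [h2] at hu
    simp at hu
  refine ⟨u.ofLp ⬝ᵥ Ψ *ᵥ u.ofLp, by simpa using hΨ.dotProduct_mulVec_pos hu0, fun x => ?_⟩
  rcases eq_or_ne x 0 with rfl | hx
  · simp
  set X : EuclideanSpace ℝ κ := WithLp.toLp 2 x with hX
  have hX0 : 0 < ‖X‖ := by
    rw [norm_pos_iff]
    intro h
    exact hx (by simpa [hX] using congrArg WithLp.ofLp h)
  have hXX : x ⬝ᵥ x = ‖X‖ ^ 2 := by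
    rw [EuclideanSpace.real_norm_sq_eq, dotProduct]
    exact Finset.sum_congr rfl fun i _ => (sq _).symm
  have h3 : ‖X‖⁻¹ • X ∈ Metric.sphere (0 : EuclideanSpace ℝ κ) 1 := by
    rw [mem_sphere_zero_iff_norm, norm_smul, norm_inv, norm_norm, inv_mul_cancel₀ hX0.ne']
  have h4 : u.ofLp ⬝ᵥ Ψ *ᵥ u.ofLp ≤ (‖X‖⁻¹ • x) ⬝ᵥ Ψ *ᵥ (‖X‖⁻¹ • x) := hmin h3
  rw [Matrix.mulVec_smul, dotProduct_smul, smul_dotProduct, smul_eq_mul, smul_eq_mul,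
    ← mul_assoc, ← mul_inv, ← sq, inv_mul_eq_div, le_div_iff₀ (by positivity)] at h4
  rwa [hXX]

/-- A lower bound for a quadratic form survives an entrywise perturbation of its matrix. -/
theorem sub_mul_le_of_abs_sub_le {Ψ Γ : Matrix κ κ ℝ} {c η : ℝ}
    (hΨ : ∀ x : κ → ℝ, c * (x ⬝ᵥ x) ≤ x ⬝ᵥ Ψ *ᵥ x) (h : ∀ s t, |Γ s t - Ψ s t| ≤ η)
    (x : κ → ℝ) : (c - η * Fintype.card κ) * (x ⬝ᵥ x) ≤ x ⬝ᵥ Γ *ᵥ x := by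
  have h1 : x ⬝ᵥ Ψ *ᵥ x - x ⬝ᵥ Γ *ᵥ x ≤ ∑ s, ∑ t, η * ((x s * x s + x t * x t) / 2) := by
    rw [← dotProduct_sub, ← Matrix.sub_mulVec, dotProduct]
    refine Finset.sum_le_sum fun s _ => ?_
    rw [Matrix.mulVec, dotProduct, Finset.mul_sum]
    refine Finset.sum_le_sum fun t _ => ?_
    have h2 : x s * ((Ψ - Γ) s t * x t) ≤ |Γ s t - Ψ s t| * |x s * x t| := by
      rw [← abs_mul]
      refine le_trans (le_of_eq ?_) (neg_abs_le _ |> fun h => neg_le.1 h)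
      rw [Matrix.sub_apply]
      ring
    have h3 : |x s * x t| ≤ (x s * x s + x t * x t) / 2 := by
      rw [abs_le]
      constructor <;> nlinarith [sq_nonneg (x s + x t), sq_nonneg (x s - x t)]
    calc _ ≤ _ := h2
      _ ≤ η * |x s * x t| := mul_le_mul_of_nonneg_right (h s t) (abs_nonneg _)
      _ ≤ _ := mul_le_mul_of_nonneg_left h3 ((abs_nonneg _).trans (h s t))
  have h4 : ∑ s, ∑ t, η * ((x s * x s + x t * x t) / 2) = η * Fintype.card κ * (x ⬝ᵥ x) := by
    simp only [← Finset.mul_sum, ← Finset.sum_div, Finset.sum_add_distrib, Finset.sum_const,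
      Finset.card_univ, nsmul_eq_mul, dotProduct]
    have h5 : ∑ s, x s * (Fintype.card κ * x s) = Fintype.card κ * ∑ s, x s * x s := by
      rw [Finset.mul_sum]
      exact Finset.sum_congr rfl fun s _ => by ring
    rw [h5]
    ring
  have h5 := hΨ x
  rw [h4] at h1
  linarith

/-- If the normalized Gram matrices `Γ` converge to a positive definite `Ψ`, they are eventually
uniformly positive definite. -/
theorem eventually_mul_le_gram {ι : Type*} {f : Filter ι} {Ψ : Matrix κ κ ℝ} {c : ℝ} (hc : 0 < c)
    (hΨ : ∀ x : κ → ℝ, c * (x ⬝ᵥ x) ≤ x ⬝ᵥ Ψ *ᵥ x) {Γ : ι → Matrix κ κ ℝ}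
    (h : ∀ s t, Tendsto (fun a => Γ a s t) f (𝓝 (Ψ s t))) :
    ∀ᶠ a in f, ∀ x : κ → ℝ, c / 2 * (x ⬝ᵥ x) ≤ x ⬝ᵥ Γ a *ᵥ x := by
  set η := c / (2 * (Fintype.card κ + 1)) with hη
  have hη0 : 0 < η := by positivity
  have h1 : ∀ᶠ a in f, ∀ s t, |Γ a s t - Ψ s t| < η := by
    simp only [eventually_all]
    intro s t
    filter_upwards [(h s t).eventually (Metric.ball_mem_nhds _ hη0)] with a ha
    exact ha
  filter_upwards [h1] with a ha x
  refine le_trans ?_ (sub_mul_le_of_abs_sub_le hΨ (fun s t => (ha s t).le) x)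
  refine mul_le_mul_of_nonneg_right ?_ (Finset.sum_nonneg fun i _ => mul_self_nonneg _)
  have h2 : η * (Fintype.card κ + 1) = c / 2 := by
    rw [hη]; field_simp
  linarith

/-- If `Γₐ → Ψ` and `Nₐ → ∞`, then `log det (I + B (Nₐ Γₐ))` grows at most like `log Nₐ`. -/
theorem exists_log_det_le [DecidableEq κ] {Ψ : Matrix κ κ ℝ} {Γ : ℕ → Matrix κ κ ℝ}
    (h : ∀ s t, Tendsto (fun a => Γ a s t) atTop (𝓝 (Ψ s t))) (B : Matrix κ κ ℝ)
    {N : ℕ → ℕ} (hN : Tendsto N atTop atTop) :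
    ∃ C : ℝ, ∀ᶠ a in atTop, Real.log (1 + B * ((N a : ℝ) • Γ a)).det ≤
      Fintype.card κ * Real.log (N a) + C := by
  have hN' : Tendsto (fun a => (N a : ℝ)) atTop atTop :=
    tendsto_natCast_atTop_atTop.comp hN
  have hΓ : Tendsto Γ atTop (𝓝 Ψ) := tendsto_pi_nhds.2 fun s => tendsto_pi_nhds.2 fun t => h s t
  have hlim : Tendsto (fun a => ((N a : ℝ)⁻¹ • (1 : Matrix κ κ ℝ) + B * Γ a).det) atTop
      (𝓝 (B * Ψ).det) := by
    have h1 : Tendsto (fun a => (N a : ℝ)⁻¹ • (1 : Matrix κ κ ℝ)) atTop (𝓝 0) := by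
      have h2 := (tendsto_inv_atTop_zero.comp hN').smul_const (1 : Matrix κ κ ℝ)
      rw [zero_smul] at h2
      exact h2
    have hB : Continuous fun M : Matrix κ κ ℝ => B * M := continuous_const.matrix_mul continuous_id
    have h3 := h1.add ((hB.tendsto Ψ).comp hΓ)
    rw [zero_add] at h3
    exact ((continuous_id.matrix_det (n := κ) (R := ℝ)).tendsto _).comp h3
  refine ⟨Real.log (|(B * Ψ).det| + 1), ?_⟩
  filter_upwards [hlim.abs.eventually (gt_mem_nhds (lt_add_one _)), hN.eventually_ge_atTop 1]
    with a ha hN1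
  have hNpos : (0 : ℝ) < N a := by exact_mod_cast hN1
  have h4 : (1 + B * ((N a : ℝ) • Γ a)).det =
      (N a : ℝ) ^ Fintype.card κ * ((N a : ℝ)⁻¹ • (1 : Matrix κ κ ℝ) + B * Γ a).det := by
    rw [← Matrix.det_smul, smul_add, smul_smul, mul_inv_cancel₀ hNpos.ne', one_smul,
      Matrix.mul_smul]
  rw [h4]
  set e := ((N a : ℝ)⁻¹ • (1 : Matrix κ κ ℝ) + B * Γ a).det
  have hN0 : 0 ≤ Fintype.card κ * Real.log (N a) :=
    mul_nonneg (Nat.cast_nonneg _) (Real.log_nonneg (by exact_mod_cast hN1))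
  have hC0 : 0 ≤ Real.log (|(B * Ψ).det| + 1) :=
    Real.log_nonneg (by linarith [abs_nonneg (B * Ψ).det])
  -- the sign of the determinant is not needed, since `Real.log` is even and `Real.log 0 = 0`
  rcases eq_or_ne e 0 with he | he
  · rw [he, mul_zero, Real.log_zero]
    exact add_nonneg hN0 hC0
  · rw [Real.log_mul (pow_ne_zero _ hNpos.ne') he, Real.log_pow, ← Real.log_abs e]
    have := Real.log_le_log (abs_pos.2 he) ha.le
    linarith

end Perturbation

section Limit

variable {p : ℕ} {k : Fin p → ℕ} {θ : (i : Fin p) → EuclideanSpace ℝ (Fin (k i))} {σ γ : ℝ}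
  {Ψ : Matrix (Idx k) (Idx k) ℝ} {q : ℝ≥0∞} [Fact (1 ≤ q)] {R : ℝ} {N : ℕ → ℕ}
  {G : (a : ℕ) → Fin (N a) → Idx k → ℝ} {v : (a : ℕ) → Fin (N a) → ℝ} {l : ℕ → Fin p → ℝ}

/-- The posterior mean at the estimated hyperparameters is consistent. -/
theorem tendsto_posteriorError (hk : ∀ i, 0 < k i) (hσ : 0 < σ) (hγ : 0 ≤ γ)
    {c : ℝ} (hc : 0 < c) (hΨ : ∀ x : Idx k → ℝ, c * (x ⬝ᵥ x) ≤ x ⬝ᵥ Ψ *ᵥ x)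
    (hR : lqNorm q (fun i => ‖θ i‖ ^ 2 / (k i : ℝ)) ≤ R) (hN : Tendsto N atTop atTop)
    (hG : ∀ s t, Tendsto (fun a => ((Matrix.of (G a))ᵀ * Matrix.of (G a)) s t / (N a : ℝ)) atTop
      (𝓝 (Ψ s t)))
    (hv : ∀ s, Tendsto (fun a => ((Matrix.of (G a))ᵀ *ᵥ v a) s / (N a : ℝ)) atTop (𝓝 0))
    (hE : ∀ a, IsEstimate q R σ γ (G a) (observation θ (G a) (v a)) (l a)) (s : Idx k) :
    Tendsto (fun a => posteriorError σ θ (G a) (v a) (l a) s) atTop (𝓝 0) := by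
  set A : (a : ℕ) → Matrix (Fin (N a)) (Idx k) ℝ := fun a => Matrix.of (G a) with hA
  set x : ℕ → Idx k → ℝ := fun a => posteriorError σ θ (G a) (v a) (l a) with hx
  set Γ : ℕ → Matrix (Idx k) (Idx k) ℝ := fun a => (N a : ℝ)⁻¹ • ((A a)ᵀ * A a) with hΓ
  set w : ℕ → Idx k → ℝ := fun a => (N a : ℝ)⁻¹ • ((A a)ᵀ *ᵥ v a) with hw
  have hΓlim : ∀ s t, Tendsto (fun a => Γ a s t) atTop (𝓝 (Ψ s t)) := fun s t =>
    (hG s t).congr fun a => by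
      simp only [hΓ, hA, Matrix.smul_apply, smul_eq_mul, div_eq_inv_mul]
  have hwlim : Tendsto (fun a => w a ⬝ᵥ w a) atTop (𝓝 0) := by
    have h1 : ∀ s, Tendsto (fun a => w a s) atTop (𝓝 0) := fun s =>
      (hv s).congr fun a => by
        simp only [hw, hA, Pi.smul_apply, smul_eq_mul, div_eq_inv_mul]
    have h2 := tendsto_finsetSum Finset.univ fun s _ => (h1 s).mul (h1 s)
    simp only [mul_zero, Finset.sum_const_zero] at h2
    exact h2
  set B : Matrix (Idx k) (Idx k) ℝ :=
    (σ ^ 2)⁻¹ • Matrix.diagonal (fun s : Idx k => ‖θ s.1‖ ^ 2 / (k s.1 : ℝ)) with hB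
  obtain ⟨C, hC⟩ := exists_log_det_le hΓlim B hN
  set K : ℝ := ∑ i, (k i : ℝ) + 2 * γ * ∑ i, ‖θ i‖ ^ 2 / (k i : ℝ) + C with hK
  set b : ℕ → ℝ := fun a =>
    σ ^ 2 * (K * (N a : ℝ)⁻¹ + Fintype.card (Idx k) * (Real.log (N a) / N a)) with hb
  have hN' : Tendsto (fun a => (N a : ℝ)) atTop atTop := tendsto_natCast_atTop_atTop.comp hN
  have hblim : Tendsto b atTop (𝓝 0) := by
    have h1 : Tendsto (fun a => Real.log (N a) / N a) atTop (𝓝 0) :=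
      Real.isLittleO_log_id_atTop.tendsto_div_nhds_zero.comp hN'
    have h2 := (((tendsto_inv_atTop_zero.comp hN').const_mul K).add
      (h1.const_mul (Fintype.card (Idx k) : ℝ))).const_mul (σ ^ 2)
    simp only [mul_zero, add_zero] at h2
    exact h2
  have hbound : ∀ᶠ a in atTop, x a ⬝ᵥ x a ≤ 4 / c * (4 / c * (w a ⬝ᵥ w a) + b a) := by
    filter_upwards [hC, eventually_mul_le_gram hc hΨ hΓlim, hN.eventually_ge_atTop 1]
      with a hCa hca hN1
    have hNpos : (0 : ℝ) < N a := by exact_mod_cast hN1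
    have h1 := (hE a).energy_le hσ hγ hk hR
    have hgram : (A a)ᵀ * A a = (N a : ℝ) • Γ a := by
      rw [hΓ, smul_smul, mul_inv_cancel₀ hNpos.ne', one_smul]
    have hcross : (A a)ᵀ *ᵥ v a = (N a : ℝ) • w a := by
      rw [hw, smul_smul, mul_inv_cancel₀ hNpos.ne', one_smul]
    change x a ⬝ᵥ ((A a)ᵀ * A a) *ᵥ x a - 2 * (x a ⬝ᵥ (A a)ᵀ *ᵥ v a) ≤ σ ^ 2 * (_ +
      Real.log (1 + (σ ^ 2)⁻¹ • (_ * ((A a)ᵀ * A a))).det) at h1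
    rw [← Matrix.smul_mul, ← hB, hgram, hcross, Matrix.smul_mulVec, dotProduct_smul,
      dotProduct_smul, smul_eq_mul, smul_eq_mul] at h1
    have h2 : (N a : ℝ) * (x a ⬝ᵥ Γ a *ᵥ x a - 2 * (x a ⬝ᵥ w a)) ≤ N a * b a := by
      have h3 : N a * b a = σ ^ 2 * (K + Fintype.card (Idx k) * Real.log (N a)) := by
        rw [hb]; field_simp
      rw [h3]
      have h4 := mul_le_mul_of_nonneg_left hCa (sq_nonneg σ)
      rw [hK]
      linarith
    have h5 := le_of_mul_le_mul_left h2 hNpos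
    -- Young's inequality `2 x·w ≤ (c / 4) ‖x‖² + (4 / c) ‖w‖²`
    have h6 : 2 * (x a ⬝ᵥ w a) ≤ c / 4 * (x a ⬝ᵥ x a) + 4 / c * (w a ⬝ᵥ w a) := by
      simp only [dotProduct, Finset.mul_sum, ← Finset.sum_add_distrib]
      refine Finset.sum_le_sum fun s _ => ?_
      have h7 : 0 ≤ c / 4 * (x a s - 4 / c * w a s) ^ 2 := by positivity
      have h8 : c / 4 * (x a s - 4 / c * w a s) ^ 2 =
          c / 4 * (x a s * x a s) + 4 / c * (w a s * w a s) - 2 * (x a s * w a s) := by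
        field_simp
        ring
      linarith
    have h9 := hca (x a)
    have h10 : c / 4 * (x a ⬝ᵥ x a) ≤ 4 / c * (w a ⬝ᵥ w a) + b a := by linarith
    calc x a ⬝ᵥ x a = 4 / c * (c / 4 * (x a ⬝ᵥ x a)) := by field_simp
      _ ≤ _ := mul_le_mul_of_nonneg_left h10 (by positivity)
  have hup : Tendsto (fun a => √(4 / c * (4 / c * (w a ⬝ᵥ w a) + b a))) atTop (𝓝 0) := by
    have h1 := ((((hwlim.const_mul (4 / c)).add hblim).const_mul (4 / c))).sqrt
    simpa using h1
  refine squeeze_zero_norm' ?_ hup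
  filter_upwards [hbound] with a ha
  rw [Real.norm_eq_abs]
  refine Real.abs_le_sqrt (le_trans ?_ ha)
  rw [sq]
  exact Finset.single_le_sum (f := fun s => x a s * x a s) (fun s _ => mul_self_nonneg _)
    (Finset.mem_univ s)

/-- The stationarity equation `kᵢ λᵢ + 2 γ λᵢ² = ‖θ⁽ⁱ⁾‖²` holds in the limit. -/
theorem tendsto_stationarity (hk : ∀ i, 0 < k i) (hσ : 0 < σ) (hγ : 0 ≤ γ) (hΨ : Ψ.PosDef)
    (hR : lqNorm q (fun i => ‖θ i‖ ^ 2 / (k i : ℝ)) < R) (hN : Tendsto N atTop atTop)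
    (hG : ∀ s t, Tendsto (fun a => ((Matrix.of (G a))ᵀ * Matrix.of (G a)) s t / (N a : ℝ)) atTop
      (𝓝 (Ψ s t)))
    (hv : ∀ s, Tendsto (fun a => ((Matrix.of (G a))ᵀ *ᵥ v a) s / (N a : ℝ)) atTop (𝓝 0))
    (hE : ∀ a, IsEstimate q R σ γ (G a) (observation θ (G a) (v a)) (l a)) (i : Fin p) :
    Tendsto (fun a => k i * l a i + 2 * γ * l a i ^ 2) atTop (𝓝 (‖θ i‖ ^ 2)) := by
  obtain ⟨c, hc, hcΨ⟩ := exists_pos_mul_le_of_posDef hΨ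
  have hx := tendsto_posteriorError hk hσ hγ hc hcΨ hR.le hN hG hv hE
  have hN' : Tendsto (fun a => (N a : ℝ)) atTop atTop := tendsto_natCast_atTop_atTop.comp hN
  set lo : Fin p → ℕ → ℝ := fun j a =>
    ∑ b, (θ j b + posteriorError σ θ (G a) (v a) (l a) ⟨j, b⟩) ^ 2 with hlo
  have hlolim : ∀ j, Tendsto (lo j) atTop (𝓝 (‖θ j‖ ^ 2)) := by
    intro j
    have h1 := tendsto_finsetSum (Finset.univ : Finset (Fin (k j)))
      fun b _ => ((hx ⟨j, b⟩).const_add (θ j b)).pow 2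
    rw [EuclideanSpace.real_norm_sq_eq]
    simpa using h1
  set up : Fin p → ℕ → ℝ := fun j a => lo j a + k j * (σ ^ 2 / (c / 2 * N a)) with hup
  have huplim : ∀ j, Tendsto (up j) atTop (𝓝 (‖θ j‖ ^ 2)) := by
    intro j
    have h1 : Tendsto (fun a => σ ^ 2 / (c / 2 * N a)) atTop (𝓝 0) :=
      tendsto_const_nhds.div_atTop (hN'.const_mul_atTop (by positivity))
    simpa using (hlolim j).add (h1.const_mul (k j : ℝ))
  have hupper : ∀ᶠ a in atTop, ∀ j, k j * l a j + 2 * γ * l a j ^ 2 ≤ up j a := by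
    have hΓ : ∀ s t, Tendsto (fun a => ((N a : ℝ)⁻¹ • ((Matrix.of (G a))ᵀ * Matrix.of (G a))) s t)
        atTop (𝓝 (Ψ s t)) := fun s t => (hG s t).congr fun a => by
      rw [Matrix.smul_apply, smul_eq_mul, div_eq_inv_mul]
    filter_upwards [eventually_mul_le_gram hc hcΨ hΓ, hN.eventually_ge_atTop 1] with a ha hN1 j
    have hNpos : (0 : ℝ) < N a := by exact_mod_cast hN1
    refine (hE a).le_sum_sq hσ (by positivity) (fun x => ?_) j
    have h1 := mul_le_mul_of_nonneg_left (ha x) hNpos.le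
    rw [Matrix.smul_mulVec, dotProduct_smul, smul_eq_mul, mul_inv_cancel_left₀ hNpos.ne'] at h1
    linarith
  -- the upper bounds alone place the estimate strictly inside the ball
  have hinside : ∀ᶠ a in atTop, lqNorm q (l a) < R := by
    have h1 : Tendsto (fun a => lqNorm q (fun j => up j a / (k j : ℝ))) atTop
        (𝓝 (lqNorm q (fun j => ‖θ j‖ ^ 2 / (k j : ℝ)))) :=
      ((continuous_lqNorm q).tendsto _).comp
        (tendsto_pi_nhds.2 fun j => (huplim j).div_const (k j : ℝ))
    filter_upwards [h1.eventually (gt_mem_nhds hR), hupper] with a ha hua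
    refine lt_of_le_of_lt (lqNorm_mono q (hE a).1.2 fun j => ?_) ha
    have hkj : (0 : ℝ) < k j := by exact_mod_cast hk j
    rw [le_div_iff₀ hkj]
    have h2 : 0 ≤ 2 * γ * l a j ^ 2 := by positivity
    linarith [hua j]
  refine tendsto_of_tendsto_of_tendsto_of_le_of_le' (hlolim i) (huplim i) ?_ ?_
  · filter_upwards [hinside] with a ha
    exact (hE a).sum_sq_le hσ ha i
  · filter_upwards [hupper] with a ha
    exact ha i

/-- Quantitative form: the estimate is close to the nonnegative root of the limiting stationarity
equation as soon as the sample is large and its second moments are close to their means. -/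
theorem exists_tolerance (hk : ∀ i, 0 < k i) (hσ : 0 < σ) (hγ : 0 ≤ γ) (hΨ : Ψ.PosDef)
    (hR : lqNorm q (fun i => ‖θ i‖ ^ 2 / (k i : ℝ)) < R) (i : Fin p) {r : ℝ} (hr : 0 ≤ r)
    (hroot : k i * r + 2 * γ * r ^ 2 = ‖θ i‖ ^ 2) {ε : ℝ} (hε : 0 < ε) :
    ∃ η : ℝ, 0 < η ∧ ∃ n₀ : ℕ, ∀ n ≥ n₀, ∀ (G : Fin n → Idx k → ℝ) (v : Fin n → ℝ)
      (l : Fin p → ℝ),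
      (∀ s t, |((Matrix.of G)ᵀ * Matrix.of G) s t / (n : ℝ) - Ψ s t| < η) →
      (∀ s, |((Matrix.of G)ᵀ *ᵥ v) s / (n : ℝ)| < η) →
      IsEstimate q R σ γ G (observation θ G v) l → |l i - r| < ε := by
  by_contra! hcon
  have hη : ∀ a : ℕ, (0 : ℝ) < 1 / ((a : ℝ) + 1) := fun a => by positivity
  choose N hNa G v l hG hv hE hfar using fun a : ℕ => hcon _ (hη a) a
  have hN : Tendsto N atTop atTop := tendsto_atTop_mono hNa tendsto_id
  have h0 : Tendsto (fun a : ℕ => 1 / ((a : ℝ) + 1)) atTop (𝓝 0) :=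
    tendsto_one_div_add_atTop_nhds_zero_nat
  have h1 := tendsto_stationarity hk hσ hγ hΨ hR hN
    (fun s t => tendsto_iff_norm_sub_tendsto_zero.2
      (squeeze_zero (fun _ => norm_nonneg _) (fun a => (hG a s t).le) h0))
    (fun s => squeeze_zero_norm (fun a => (hv a s).le) h0) hE i
  have hki : (1 : ℝ) ≤ k i := by exact_mod_cast hk i
  have h2 := h1.eventually (Metric.ball_mem_nhds _ hε)
  obtain ⟨a, ha⟩ := h2.exists
  have ha' : |k i * l a i + 2 * γ * l a i ^ 2 - ‖θ i‖ ^ 2| < ε := ha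
  have hla := (hE a).1.2 i
  -- `λ ↦ kᵢ λ + 2 γ λ²` has slope at least `kᵢ ≥ 1` on the half-line
  have h3 : k i * l a i + 2 * γ * l a i ^ 2 - ‖θ i‖ ^ 2 =
      (l a i - r) * (k i + 2 * γ * (l a i + r)) := by
    rw [← hroot]; ring
  have h4 : 1 ≤ k i + 2 * γ * (l a i + r) := by
    have : 0 ≤ 2 * γ * (l a i + r) := by positivity
    linarith
  rw [h3, abs_mul, abs_of_nonneg (zero_le_one.trans h4)] at ha'
  have h5 := le_mul_of_one_le_right (abs_nonneg (l a i - r)) h4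
  linarith [hfar a]

end Limit

/-! ### Laws of large numbers for the sample second moments -/

section Probability

variable {Ω : Type*} [MeasurableSpace Ω] {P : Measure Ω}

/-- Weak law of large numbers for a triangular array whose `n`-th row is an i.i.d. sample of size
`n`. No joint law of the rows is prescribed; each row has the law of the first `n` coordinates of
one infinite i.i.d. sequence, to which the strong law applies. -/
theorem tendsto_measure_sample_mean {E : Type*} [MeasurableSpace E] {μ : Measure E}
    [IsProbabilityMeasure μ] {f : E → ℝ} (hf : Measurable f) (hint : Integrable f μ)
    {X : (n : ℕ) → Ω → Fin n → E} (hX : ∀ n, HasLaw (X n) (Measure.pi fun _ : Fin n => μ) P)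
    {ε : ℝ} (hε : 0 < ε) :
    Tendsto (fun n : ℕ => P {ω | ε ≤ |(∑ j, f (X n ω j)) / (n : ℝ) - ∫ x, f x ∂μ|}) atTop
      (𝓝 0) := by
  set ν : Measure (ℕ → E) := Measure.infinitePi fun _ : ℕ => μ with hν
  have hcoord : ∀ i : ℕ, HasLaw (fun x : ℕ → E => x i) μ ν := fun i =>
    (measurePreserving_eval_infinitePi (fun _ : ℕ => μ) i).hasLaw
  have hindep : iIndepFun (fun (i : ℕ) (x : ℕ → E) => f (x i)) ν :=
    iIndepFun_infinitePi (X := fun _ => f) fun _ => hf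
  have hmean : ∫ x : ℕ → E, f (x 0) ∂ν = ∫ x, f x ∂μ :=
    (hcoord 0).integral_comp hf.aestronglyMeasurable
  have hident : ∀ i : ℕ, IdentDistrib (fun x : ℕ → E => f (x i)) (fun x => f (x 0)) ν ν :=
    fun i => IdentDistrib.comp (u := f)
      ⟨(measurable_pi_apply i).aemeasurable, (measurable_pi_apply 0).aemeasurable, by
        rw [(hcoord i).map_eq, (hcoord 0).map_eq]⟩ hf
  have hint0 : Integrable (fun x : ℕ → E => f (x 0)) ν :=
    (measurePreserving_eval_infinitePi (fun _ : ℕ => μ) 0).integrable_comp_of_integrable hint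
  have hslln := strong_law_ae_real (fun (i : ℕ) (x : ℕ → E) => f (x i)) hint0
    (fun i j hij => hindep.indepFun hij) hident
  rw [hmean] at hslln
  have hmeas : ∀ n : ℕ, Measurable fun x : ℕ → E => (∑ i ∈ Finset.range n, f (x i)) / (n : ℝ) :=
    fun n => (Finset.measurable_sum _ fun i _ => hf.comp (measurable_pi_apply i)).div_const _
  have hwlln := tendstoInMeasure_of_tendsto_ae (fun n => (hmeas n).aestronglyMeasurable) hslln
  refine (tendstoInMeasure_iff_norm.1 hwlln ε hε).congr fun n => ?_
  have hlaw : HasLaw (fun (x : ℕ → E) (j : Fin n) => x j) (Measure.pi fun _ : Fin n => μ) ν :=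
    ⟨(measurable_pi_lambda _ fun j => measurable_pi_apply _).aemeasurable, by
      rw [hν, Measure.map_infinitePi_infinitePi_of_inj Fin.val_injective,
        Measure.infinitePi_eq_pi]⟩
  have hset : MeasurableSet
      {x : Fin n → E | ε ≤ |(∑ j, f (x j)) / (n : ℝ) - ∫ x, f x ∂μ|} := by
    refine measurableSet_le measurable_const ?_
    have h1 : Measurable fun x : Fin n → E => ∑ j, f (x j) :=
      Finset.measurable_sum _ fun j _ => hf.comp (measurable_pi_apply j)
    exact ((h1.div_const _).sub_const _).abs
  rw [(hX n).measure_eq hset, ← hlaw.measure_eq hset]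
  simp only [Finset.sum_range, Real.norm_eq_abs]

variable {p : ℕ} {k : Fin p → ℕ} {ρ : Measure (Idx k → ℝ)}
  [IsProbabilityMeasure ρ] {G : (n : ℕ) → Ω → Fin n → Idx k → ℝ} {v : (n : ℕ) → Ω → Fin n → ℝ}

theorem tendsto_measure_gram {Ψ : Matrix (Idx k) (Idx k) ℝ}
    (hρ_sq : ∀ s, MemLp (fun x => x s) 2 ρ) (hρ_mean : ∀ s, ∫ x, x s ∂ρ = 0)
    (hρ_cov : ∀ s t, covariance (fun x => x s) (fun x => x t) ρ = Ψ s t)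
    (hG : ∀ n, HasLaw (G n) (Measure.pi fun _ : Fin n => ρ) P) (s t : Idx k)
    {η : ℝ} (hη : 0 < η) :
    Tendsto (fun n : ℕ => P {ω | η ≤
      |((Matrix.of (G n ω))ᵀ * Matrix.of (G n ω)) s t / (n : ℝ) - Ψ s t|}) atTop (𝓝 0) := by
  have h1 : ∫ x, x s * x t ∂ρ = Ψ s t := by
    rw [← hρ_cov s t, covariance_eq_sub (hρ_sq s) (hρ_sq t), hρ_mean s, zero_mul, sub_zero]
    rfl
  have h2 := tendsto_measure_sample_mean (f := fun x : Idx k → ℝ => x s * x t)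
    ((measurable_pi_apply s).mul (measurable_pi_apply t))
    ((hρ_sq s).integrable_mul (hρ_sq t)) hG hη
  rw [h1] at h2
  exact h2

theorem tendsto_measure_cross [IsProbabilityMeasure P] {τ : NNReal}
    (hρ_sq : ∀ s, MemLp (fun x => x s) 2 ρ)
    (hG : ∀ n, HasLaw (G n) (Measure.pi fun _ : Fin n => ρ) P)
    (hv : ∀ n, HasLaw (v n) (Measure.pi fun _ : Fin n => gaussianReal 0 τ) P)
    (hGv : ∀ n, IndepFun (G n) (v n) P) (s : Idx k) {η : ℝ} (hη : 0 < η) :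
    Tendsto (fun n : ℕ => P {ω | η ≤ |((Matrix.of (G n ω))ᵀ *ᵥ v n ω) s / (n : ℝ)|})
      atTop (𝓝 0) := by
  set μ := ρ.prod (gaussianReal 0 τ) with hμ
  -- the pairs of a row and its noise term are an i.i.d. sample
  have hX : ∀ n, HasLaw (fun ω (j : Fin n) => (G n ω j, v n ω j))
      (Measure.pi fun _ : Fin n => μ) P := fun n =>
    ((measurePreserving_arrowProdEquivProdArrow (Idx k → ℝ) ℝ (Fin n) (fun _ => ρ)
      (fun _ => gaussianReal 0 τ)).symm.hasLaw).comp ((hGv n).hasLaw_prod (hG n) (hv n))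
  have hint : Integrable (fun x : (Idx k → ℝ) × ℝ => x.1 s * x.2) μ :=
    Integrable.mul_prod ((hρ_sq s).integrable one_le_two)
      ((memLp_id_gaussianReal 1).integrable le_rfl)
  have h1 : ∫ x : (Idx k → ℝ) × ℝ, x.1 s * x.2 ∂μ = 0 := by
    rw [hμ, integral_prod_mul (fun x : Idx k → ℝ => x s) (fun x : ℝ => x)]
    simp
  have h2 := tendsto_measure_sample_mean (f := fun x : (Idx k → ℝ) × ℝ => x.1 s * x.2)
    (by fun_prop) hint hX hη
  rw [h1] at h2
  simp only [sub_zero] at h2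
  exact h2

/-- Convergence in probability to the nonnegative root of the stationarity equation. -/
theorem tendstoInMeasure_estimate [IsProbabilityMeasure P] (hk : ∀ i, 0 < k i)
    {θ : (i : Fin p) → EuclideanSpace ℝ (Fin (k i))} {σ : ℝ} (hσ : 0 < σ) {γ : ℝ} (hγ : 0 ≤ γ)
    {Ψ : Matrix (Idx k) (Idx k) ℝ} (hΨ : Ψ.PosDef)
    (hρ_sq : ∀ s, MemLp (fun x => x s) 2 ρ) (hρ_mean : ∀ s, ∫ x, x s ∂ρ = 0)
    (hρ_cov : ∀ s t, covariance (fun x => x s) (fun x => x t) ρ = Ψ s t)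
    {τ : NNReal} (hG : ∀ n, HasLaw (G n) (Measure.pi fun _ : Fin n => ρ) P)
    (hv : ∀ n, HasLaw (v n) (Measure.pi fun _ : Fin n => gaussianReal 0 τ) P)
    (hGv : ∀ n, IndepFun (G n) (v n) P) {q : ℝ≥0∞} [Fact (1 ≤ q)] {R : ℝ}
    (hR : lqNorm q (fun i => ‖θ i‖ ^ 2 / (k i : ℝ)) < R) {lhat : (n : ℕ) → Ω → Fin p → ℝ}
    (hE : ∀ n, ∀ᵐ ω ∂P, IsEstimate q R σ γ (G n ω) (observation θ (G n ω) (v n ω)) (lhat n ω))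
    (i : Fin p) {r : ℝ} (hr : 0 ≤ r) (hroot : k i * r + 2 * γ * r ^ 2 = ‖θ i‖ ^ 2) :
    TendstoInMeasure P (fun n ω => lhat n ω i) atTop (fun _ => r) := by
  rw [tendstoInMeasure_iff_norm]
  intro ε hε
  obtain ⟨η, hη, n₀, hn₀⟩ := exists_tolerance (θ := θ) hk hσ hγ hΨ hR i hr hroot hε
  set E₁ : ℕ → Idx k → Idx k → Set Ω := fun n s t => {ω | η ≤
    |((Matrix.of (G n ω))ᵀ * Matrix.of (G n ω)) s t / (n : ℝ) - Ψ s t|} with hE₁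
  set E₂ : ℕ → Idx k → Set Ω := fun n s => {ω | η ≤
    |((Matrix.of (G n ω))ᵀ *ᵥ v n ω) s / (n : ℝ)|} with hE₂
  have hlim : Tendsto (fun n => ∑ s, ∑ t, P (E₁ n s t) + ∑ s, P (E₂ n s)) atTop (𝓝 0) := by
    have h1 := tendsto_finsetSum Finset.univ fun s (_ : s ∈ Finset.univ) =>
      tendsto_finsetSum Finset.univ fun t (_ : t ∈ Finset.univ) =>
        tendsto_measure_gram hρ_sq hρ_mean hρ_cov hG s t hη
    have h2 := tendsto_finsetSum Finset.univ fun s (_ : s ∈ Finset.univ) =>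
        tendsto_measure_cross hρ_sq hG hv hGv s hη
    have h3 := h1.add h2
    simp only [Finset.sum_const_zero, add_zero] at h3
    exact h3
  refine tendsto_of_tendsto_of_tendsto_of_le_of_le' tendsto_const_nhds hlim
    (Eventually.of_forall fun _ => zero_le) ?_
  filter_upwards [eventually_ge_atTop n₀] with n hn
  have hsub : ∀ᵐ ω ∂P, ω ∈ {ω | ε ≤ ‖lhat n ω i - r‖} →
      ω ∈ (⋃ s, ⋃ t, E₁ n s t) ∪ ⋃ s, E₂ n s := by
    filter_upwards [hE n] with ω hω hfar
    by_contra hcon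
    simp only [Set.mem_union, Set.mem_iUnion, not_or, not_exists, hE₁, hE₂, Set.mem_ofPred_eq,
      not_le] at hcon
    exact absurd (hn₀ n hn _ _ _ hcon.1 hcon.2 hω) (not_lt.2 hfar)
  calc P {ω | ε ≤ ‖lhat n ω i - r‖} ≤ P ((⋃ s, ⋃ t, E₁ n s t) ∪ ⋃ s, E₂ n s) :=
        measure_mono_ae hsub
    _ ≤ P (⋃ s, ⋃ t, E₁ n s t) + P (⋃ s, E₂ n s) := measure_union_le _ _
    _ ≤ _ := add_le_add ((measure_iUnion_fintype_le _ _).trans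
        (Finset.sum_le_sum fun s _ => measure_iUnion_fintype_le _ _))
        (measure_iUnion_fintype_le _ _)

end Probability

end HGLasso

theorem mainTheorem1
    {p : ℕ} (k : Fin p → ℕ) (hk : ∀ i, 0 < k i)
    -- the true parameter, the noise level and the known hyperprior parameter
    (θ : (i : Fin p) → EuclideanSpace ℝ (Fin (k i)))
    (σ : ℝ) (hσ : 0 < σ) (γ : ℝ) (hγ : 0 ≤ γ)
    -- the law of a row: zero mean, positive definite covariance `Ψ`
    (ρ : Measure (HGLasso.Idx k → ℝ)) [IsProbabilityMeasure ρ]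
    (Ψ : Matrix (HGLasso.Idx k) (HGLasso.Idx k) ℝ) (hΨ : Ψ.PosDef)
    (hρ_sq : ∀ s, MemLp (fun x => x s) 2 ρ)
    (hρ_mean : ∀ s, ∫ x, x s ∂ρ = 0)
    (hρ_cov : ∀ s t, covariance (fun x => x s) (fun x => x t) ρ = Ψ s t)
    -- for every `n`: i.i.d. rows with law `ρ`, and independent noise with law `N(0, σ² Iₙ)`
    {Ω : Type*} [MeasurableSpace Ω] (P : Measure Ω) [IsProbabilityMeasure P]
    (G : (n : ℕ) → Ω → Fin n → HGLasso.Idx k → ℝ)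
    (v : (n : ℕ) → Ω → Fin n → ℝ)
    (hG : ∀ n, HasLaw (G n) (Measure.pi fun _ : Fin n => ρ) P)
    (hv : ∀ n, HasLaw (v n) (Measure.pi fun _ : Fin n => gaussianReal 0 (σ ^ 2).toNNReal) P)
    (hGv : ∀ n, IndepFun (G n) (v n) P)
    -- the ball; for `q = ∞` the condition on `R` reads `maxᵢ ‖θ⁽ⁱ⁾‖² / kᵢ < R`
    (q : ℝ≥0∞) [Fact (1 ≤ q)] (R : ℝ)
    (hR : HGLasso.lqNorm q (fun i => ‖θ i‖ ^ 2 / (k i : ℝ)) < R) :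
    (∀ n ω, ∃ l, HGLasso.IsEstimate q R σ γ (G n ω)
      (HGLasso.observation θ (G n ω) (v n ω)) l) ∧
    ∀ lhat : (n : ℕ) → Ω → Fin p → ℝ,
      (∀ n, ∀ᵐ ω ∂P, HGLasso.IsEstimate q R σ γ (G n ω)
        (HGLasso.observation θ (G n ω) (v n ω)) (lhat n ω)) →
      ∀ i,
        (0 < γ → 0 < ‖θ i‖ →
          TendstoInMeasure P (fun n ω => lhat n ω i) atTop
            (fun _ => (-(k i : ℝ) + Real.sqrt ((k i : ℝ) ^ 2 + 8 * γ * ‖θ i‖ ^ 2)) / (4 * γ))) ∧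
        (γ = 0 → 0 < ‖θ i‖ →
          TendstoInMeasure P (fun n ω => lhat n ω i) atTop
            (fun _ => ‖θ i‖ ^ 2 / (k i : ℝ))) ∧
        (‖θ i‖ = 0 →
          TendstoInMeasure P (fun n ω => lhat n ω i) atTop (fun _ => 0)) := by
  have ht : (fun i => ‖θ i‖ ^ 2 / (k i : ℝ)) ∈ HGLasso.feasible p q R :=
    ⟨hR.le, fun i => by positivity⟩
  refine ⟨fun n ω => HGLasso.exists_isEstimate hσ γ _ _ q ⟨_, ht⟩, fun lhat hE i => ?_⟩
  have hki : (0 : ℝ) < k i := by exact_mod_cast hk i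
  have hlim := fun r => HGLasso.tendstoInMeasure_estimate hk hσ hγ hΨ hρ_sq hρ_mean hρ_cov hG hv
    hGv hR hE i (r := r)
  refine ⟨fun hγ0 _ => hlim _ ?_ ?_, fun hγ0 _ => hlim _ (by positivity) ?_,
    fun hθ => hlim 0 le_rfl (by simp [hθ])⟩
  -- in the first case the limit is the nonnegative root of `kᵢ r + 2 γ r² = ‖θ⁽ⁱ⁾‖²`
  · have h1 : (k i : ℝ) ≤ √((k i : ℝ) ^ 2 + 8 * γ * ‖θ i‖ ^ 2) :=
      Real.le_sqrt_of_sq_le (by nlinarith [mul_nonneg hγ (sq_nonneg ‖θ i‖)])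
    exact div_nonneg (by linarith) (by positivity)
  · have h2 : √((k i : ℝ) ^ 2 + 8 * γ * ‖θ i‖ ^ 2) ^ 2 = (k i : ℝ) ^ 2 + 8 * γ * ‖θ i‖ ^ 2 :=
      Real.sq_sqrt (by positivity)
    field_simp
    nlinarith
  · rw [hγ0]
    field_simp
    ring
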